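/- Rings are unital and associative, modules are right modules. Let $\kappa$ be an infinite cardinal. A $\kappa$-monoid is a set $H$ with an element $0\in H$ and a map $\Sigma\colon H^\kappa\to H$ such that (i) $\sum_{i\in\kappa}x_i=x_0$ whenever $x_i=0$ for all $i\neq 0$, and (ii) $\sum_{i\in\kappa}\sum_{j\in\kappa}x_{i,j}=\sum_{k\in\kappa}x_{\pi^{-1}(k)}$ for every family $(x_{i,j})_{i,j\in\kappa}$ in $H$ and every bijection $\pi\colon\kappa\times\kappa\to\kappa$. For a regular cardinal $\lambda$, a $\lambda^-$-monoid is the analogous structure in which $\Sigma$ is defined exactly on the $\lambda$-indexed families with support of cardinality $<\lambda$, where (ii) is required if fewer than $\lambda$ rows and fewer than $\lambda$ columns of $(x_{i,j})$ are nonzero. Homomorphisms preserve $0$ and $\Sigma$. If $\lambda\le\kappa^+$, every $\kappa$-monoid is a $\lambda^-$-monoid, by embedding the support of a family into $\kappa$ and extending by $0$; every commutative monoid is an $\aleph_0^-$-monoid by means of its finite sums. For a $\lambda^-$-monoid $H$ with $\lambda\le\kappa^+$, a $\kappa$-monoid $\widehat H$ is a universal $\kappa$-extension of $H$ by means of a map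 $\iota\colon H\to\widehat H$ if $\iota$ is a $\lambda^-$-homomorphism and for every $\lambda^-$-homomorphism $\varphi\colon H\to K$ to a $\kappa$-monoid $K$ there is a unique $\kappa$-homomorphism $\widehat\varphi\colon\widehat H\to K$ with $\varphi=\widehat\varphi\circ\iota$. For a ring $R$, let $V^\kappa(R)$ be the $\kappa$-monoid of isomorphism classes of projective $R$-modules generated by at most $\kappa$ elements, with $\sum_i[P_i]=[\bigoplus_i P_i]$; let $V^{\lambda^-}(R)$ be the $\lambda^-$-monoid of isomorphism classes of projective $R$-modules generated by fewer than $\lambda$ elements, with the same operation; and let $V(R)$ be the commutative monoid of isomorphism classes of finitely generated projective $R$-modules, with $[P]+[Q]=[P\oplus Q]$. **Theorem.** Let $R$ be a ring and let $\kappa$ be an infinite cardinal. 1. For every regular cardinal $\lambda$ with $\aleph_1\le\lambda\le\kappa^+$, the $\kappa$-monoid $V^\kappa(R)$ is the universal $\kappa$-extension of the $\lambda^-$-monoid $V^{\lambda^-}(R)$, by means of the inclusion map. 2. $V^\kappa(R)$ is the universal $\kappa$-extension of the $\aleph_0$-monoid $V^{\aleph_0}(R)$ (considered as an $\aleph_1^-$-monoid),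 by means of the inclusion map. 3. If every projective $R$-module is a direct sum of finitely generated modules, then $V^\kappa(R)$ is the universal $\kappa$-extension of the monoid $V(R)$ (considered as an $\aleph_0^-$-monoid), by means of the inclusion map. -/

import Mathlib

open Cardinal DirectSum

universe u w w'

/-- The cardinal `κ` regarded as a set: a type of cardinality `κ`, well-ordered in the order type
of the initial ordinal of `κ`. Its least element is the element `0 ∈ κ`. -/
abbrev CardIdx (κ : Cardinal.{u}) : Type u := κ.ord.ToType

/-- A `κ`-monoid structure on `H`, for an infinite cardinal `κ`: an element `0` and an operation
`Σ : H^κ → H` satisfying the two axioms (A1) (`sum_trivial`) and (A2) (`sum_flatten`). -/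
structure KMonoid (κ : Cardinal.{u}) (H : Type w) where
  aleph0_le : ℵ₀ ≤ κ
  zero : H
  sum : (CardIdx κ → H) → H
  sum_trivial : ∀ (x : CardIdx κ → H) (i₀ : CardIdx κ), IsBot i₀ →
    (∀ i, i ≠ i₀ → x i = zero) → sum x = x i₀
  sum_flatten : ∀ (x : CardIdx κ → CardIdx κ → H) (π : CardIdx κ × CardIdx κ ≃ CardIdx κ),
    sum (fun i => sum (fun j => x i j)) = sum (fun k => x (π.symm k).1 (π.symm k).2)

/-- A `θ⁻`-monoid structure on `H`, for a regular cardinal `θ`: an element `0` and an operation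
`Σ : H^(θ) → H`, defined on the `θ`-indexed families whose support has cardinality `< θ`.
In `sum_flatten` the last three hypotheses say that the inner, the outer and the total sum are
defined; they follow from the first two. -/
structure KMinusMonoid (θ : Cardinal.{u}) (H : Type w) where
  isRegular : θ.IsRegular
  zero : H
  sum : (x : CardIdx θ → H) → #{i // x i ≠ zero} < θ → H
  sum_trivial : ∀ (x : CardIdx θ → H) (hx : #{i // x i ≠ zero} < θ) (i₀ : CardIdx θ), IsBot i₀ →
    (∀ i, i ≠ i₀ → x i = zero) → sum x hx = x i₀
  sum_flatten : ∀ (x : CardIdx θ → CardIdx θ → H) (π : CardIdx θ × CardIdx θ ≃ CardIdx θ),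
    #{i // ∃ j, x i j ≠ zero} < θ → #{j // ∃ i, x i j ≠ zero} < θ →
    ∀ (hin : ∀ i, #{j // x i j ≠ zero} < θ)
      (hout : #{i // sum (fun j => x i j) (hin i) ≠ zero} < θ)
      (htot : #{k // x (π.symm k).1 (π.symm k).2 ≠ zero} < θ),
      sum (fun i => sum (fun j => x i j) (hin i)) hout =
        sum (fun k => x (π.symm k).1 (π.symm k).2) htot

/-- `κ`-homomorphisms: maps respecting the neutral element and the operation. -/
structure IsKHom {κ : Cardinal.{u}} {H : Type w} {K : Type w'} (A : KMonoid κ H) (B : KMonoid κ K)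
    (f : H → K) : Prop where
  map_zero : f A.zero = B.zero
  map_sum : ∀ x : CardIdx κ → H, f (A.sum x) = B.sum (fun i => f (x i))

/-- `θ⁻`-homomorphisms: maps respecting the neutral element and the operation. The hypothesis `hx'`
follows from `hx` and `map_zero`. -/
structure IsKMinusHom {θ : Cardinal.{u}} {H : Type w} {K : Type w'} (A : KMinusMonoid θ H)
    (B : KMinusMonoid θ K) (f : H → K) : Prop where
  map_zero : f A.zero = B.zero
  map_sum : ∀ (x : CardIdx θ → H) (hx : #{i // x i ≠ A.zero} < θ)
    (hx' : #{i // f (x i) ≠ B.zero} < θ), f (A.sum x hx) = B.sum (fun i => f (x i)) hx'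

namespace KMonoid

variable {κ : Cardinal.{u}} {H : Type w}

theorem exists_embedding {J : Type u} (h : #J ≤ κ) : Nonempty (J ↪ CardIdx κ) := by
  rw [← Cardinal.le_def, Cardinal.mk_toType, Cardinal.card_ord]
  exact h

/-- Summation of a family `x` over an arbitrary index set `J`, with support of cardinality at most
`κ`: embed the support into `κ`, and extend by `0`. -/
noncomputable def sumOver (A : KMonoid κ H) {J : Type u} (x : J → H)
    (hx : #{j // x j ≠ A.zero} ≤ κ) : H :=
  A.sum (Function.extend (exists_embedding hx).some (fun j => x j.1) (fun _ => A.zero))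

theorem exists_bot (A : KMonoid κ H) : ∃ i : CardIdx κ, IsBot i := by
  have h : κ.ord ≠ 0 := by
    intro h
    have := A.aleph0_le
    rw [Cardinal.ord_eq_zero] at h
    exact (Cardinal.aleph0_pos.trans_le (this.trans h.le)).false
  have : Nonempty (CardIdx κ) := Ordinal.nonempty_toType_iff.2 h
  obtain ⟨m, -, hm⟩ := WellFounded.has_min (wellFounded_lt (α := CardIdx κ)) Set.univ
    ⟨this.some, trivial⟩
  exact ⟨m, fun i => not_lt.1 (hm i trivial)⟩

theorem infinite (A : KMonoid κ H) : Infinite (CardIdx κ) := by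
  rw [Cardinal.infinite_iff, Cardinal.mk_toType, Cardinal.card_ord]
  exact A.aleph0_le

theorem exists_prodEquiv (A : KMonoid κ H) :
    Nonempty (CardIdx κ × CardIdx κ ≃ CardIdx κ) := by
  have := A.infinite
  rw [← Cardinal.eq, Cardinal.mk_prod, Cardinal.lift_id]
  exact Cardinal.mul_eq_self (Cardinal.infinite_iff.1 this)

theorem sum_zero (A : KMonoid κ H) : A.sum (fun _ => A.zero) = A.zero := by
  obtain ⟨b, hb⟩ := A.exists_bot
  exact A.sum_trivial _ b hb (fun _ _ => rfl)

/-- Two injections of a set into the slice `i ↦ (i, b)` of `α × α` differ by a permutation. -/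
theorem exists_perm {α J : Type u} [Infinite α] (b : α) (e e' : J ↪ α) :
    ∃ τ : α × α ≃ α × α, ∀ j, τ (e j, b) = (e' j, b) := by
  have hc : ∀ f : J ↪ α, #((Set.range fun j => (f j, b))ᶜ : Set (α × α)) = #α := by
    intro f
    apply le_antisymm
    · refine (Cardinal.mk_set_le _).trans ?_
      rw [Cardinal.mk_prod, Cardinal.lift_id]
      exact (Cardinal.mul_eq_self (Cardinal.infinite_iff.1 inferInstance)).le
    · obtain ⟨c, hc⟩ := exists_ne b
      refine Cardinal.mk_le_of_injective (f := fun a => ⟨(a, c), ?_⟩) ?_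
      · rintro ⟨j, hj⟩
        exact hc (congrArg Prod.snd hj).symm
      · intro a a' h
        simpa using h
  let E : ∀ f : J ↪ α, J ↪ α × α := fun f => ⟨fun j => (f j, b), fun j j' h => by simpa using h⟩
  let g : (Set.range (E e)) ↪ α × α :=
    (Equiv.ofInjective (E e) (E e).injective).symm.toEmbedding.trans (E e')
  have hr : Set.range g = Set.range (E e') := by
    simp only [g, Function.Embedding.trans, Function.Embedding.coeFn_mk]
    exact (Equiv.surjective _).range_comp _
  obtain ⟨τ, hτ⟩ := Cardinal.extend_function g (by
    rw [hr, ← Cardinal.eq]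
    exact (hc e).trans (hc e').symm)
  refine ⟨τ, fun j => ?_⟩
  have h1 := hτ ⟨E e j, j, rfl⟩
  have h2 : (Equiv.ofInjective (E e) (E e).injective).symm ⟨E e j, j, rfl⟩ = j :=
    Equiv.ofInjective_symm_apply _ j
  simp only [g, Function.Embedding.trans_apply, Equiv.coe_toEmbedding, h2] at h1
  exact h1

/-- The sum of a family extended by `0` along an embedding into `κ` does not depend on the
embedding. -/
theorem sum_extend_eq (A : KMonoid κ H) {J : Type u} (x : J → H) (e e' : J ↪ CardIdx κ) :
    A.sum (Function.extend e x (fun _ => A.zero)) =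
      A.sum (Function.extend e' x (fun _ => A.zero)) := by
  classical
  have := A.infinite
  obtain ⟨b, hb⟩ := A.exists_bot
  obtain ⟨p⟩ := A.exists_prodEquiv
  obtain ⟨τ, hτ⟩ := exists_perm b e e'
  let y : (J ↪ CardIdx κ) → CardIdx κ → CardIdx κ → H := fun f i j =>
    if j = b then Function.extend f x (fun _ => A.zero) i else A.zero
  have hy : ∀ f i, A.sum (fun j => y f i j) = Function.extend f x (fun _ => A.zero) i := by
    intro f i
    rw [A.sum_trivial _ b hb (fun j hj => by simp [y, hj])]
    simp [y]
  have hin : ∀ (f : J ↪ CardIdx κ) (q : CardIdx κ × CardIdx κ), (¬ ∃ j, (f j, b) = q) →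
      y f q.1 q.2 = A.zero := by
    intro f q hq
    by_cases h : q.2 = b
    · simp only [y, h, if_true]
      rw [Function.extend_apply']
      rintro ⟨j, hj⟩
      exact hq ⟨j, Prod.ext hj h.symm⟩
    · simp [y, h]
  have hyτ : ∀ q : CardIdx κ × CardIdx κ, y e q.1 q.2 = y e' (τ q).1 (τ q).2 := by
    intro q
    by_cases hq : ∃ j, (e j, b) = q
    · obtain ⟨j, rfl⟩ := hq
      rw [hτ]
      simp [y, e.injective.extend_apply, e'.injective.extend_apply]
    · rw [hin e q hq, hin e' (τ q)]
      rintro ⟨j, hj⟩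
      exact hq ⟨j, τ.injective (by rw [hτ, hj])⟩
  calc A.sum (Function.extend e x (fun _ => A.zero))
      = A.sum (fun i => A.sum (fun j => y e i j)) := by simp_rw [hy]
    _ = A.sum (fun k => y e (p.symm k).1 (p.symm k).2) := A.sum_flatten _ p
    _ = A.sum (fun k => y e' ((τ.symm.trans p).symm k).1 ((τ.symm.trans p).symm k).2) := by
        congr 1
        funext k
        exact hyτ _
    _ = A.sum (fun i => A.sum (fun j => y e' i j)) := (A.sum_flatten _ _).symm
    _ = A.sum (Function.extend e' x (fun _ => A.zero)) := by simp_rw [hy]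

/-- `sumOver` may be computed with any embedding into `κ` of any set containing the support. -/
theorem sumOver_eq (A : KMonoid κ H) {J : Type u} (x : J → H) (hx : #{j // x j ≠ A.zero} ≤ κ)
    {L : Type u} (l : L ↪ J) (hl : ∀ j, x j ≠ A.zero → j ∈ Set.range l) (e : L ↪ CardIdx κ) :
    A.sumOver x hx = A.sum (Function.extend e (fun t => x (l t)) (fun _ => A.zero)) := by
  classical
  let c : {j // x j ≠ A.zero} ↪ L :=
    ⟨fun j => (hl j.1 j.2).choose, fun j j' h => by
      have h1 := (hl j.1 j.2).choose_spec
      have h2 := (hl j'.1 j'.2).choose_spec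
      apply Subtype.ext
      rw [← h1, ← h2]
      exact congrArg l h⟩
  have hc : ∀ j, l (c j) = j.1 := fun j => (hl j.1 j.2).choose_spec
  unfold sumOver
  rw [A.sum_extend_eq _ _ (c.trans e)]
  congr 1
  funext i
  by_cases hi : ∃ t, e t = i
  · obtain ⟨t, rfl⟩ := hi
    rw [e.injective.extend_apply]
    by_cases ht : x (l t) = A.zero
    · rw [Function.extend_apply', ht]
      rintro ⟨j, hj⟩
      have : c j = t := e.injective hj
      apply j.2
      rw [← hc j, this, ht]
    · have : c ⟨l t, ht⟩ = t := l.injective (hc _)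
      have h2 : (c.trans e) ⟨l t, ht⟩ = e t := by simp [this]
      rw [← h2, (c.trans e).injective.extend_apply]
  · rw [Function.extend_apply', Function.extend_apply']
    · exact hi
    · rintro ⟨j, hj⟩
      exact hi ⟨c j, hj⟩

/-- Every `κ`-monoid is a `θ⁻`-monoid for all regular `θ ≤ κ⁺`, by restricting the operation. -/
noncomputable def toMinus (A : KMonoid κ H) (θ : Cardinal.{u}) (hθ : θ.IsRegular)
    (hle : θ ≤ Order.succ κ) : KMinusMonoid θ H where
  isRegular := hθ
  zero := A.zero
  sum x hx := A.sumOver x (Order.le_of_lt_succ (hx.trans_le hle))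
  sum_trivial := by
    intro x hx i₀ _ h0
    obtain ⟨b, hb⟩ := A.exists_bot
    rw [A.sumOver_eq x _ (L := PUnit) ⟨fun _ => i₀, fun _ _ _ => rfl⟩
      (fun j hj => ⟨PUnit.unit, by
        by_contra hne
        exact hj (h0 j fun h => hne h.symm)⟩) ⟨fun _ => b, fun _ _ _ => rfl⟩]
    rw [A.sum_trivial _ b hb]
    · exact (Function.Embedding.injective
        (⟨fun _ => b, fun _ _ _ => rfl⟩ : PUnit.{u + 1} ↪ CardIdx κ)).extend_apply _ _ PUnit.unit
    · intro i hi
      rw [Function.extend_apply']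
      rintro ⟨_, h⟩
      exact hi h.symm
  sum_flatten := by
    intro x π hr hc hin hout htot
    classical
    obtain ⟨p⟩ := A.exists_prodEquiv
    obtain ⟨eA⟩ := exists_embedding (Order.le_of_lt_succ (hr.trans_le hle))
    obtain ⟨eB⟩ := exists_embedding (Order.le_of_lt_succ (hc.trans_le hle))
    have h1 : ∀ i, A.sumOver (fun j => x i j) (Order.le_of_lt_succ ((hin i).trans_le hle)) =
        A.sum (Function.extend eB (fun t => x i t.1) (fun _ => A.zero)) := fun i =>
      A.sumOver_eq _ _ (Function.Embedding.subtype _)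
        (fun j hj => ⟨⟨j, i, hj⟩, rfl⟩) eB
    have h2 : ∀ i, (∀ j, x i j = A.zero) →
        A.sum (Function.extend eB (fun t => x i t.1) (fun _ => A.zero)) = A.zero := by
      intro i hi
      have : Function.extend eB (fun t => x i t.1) (fun _ => A.zero) = fun _ => A.zero := by
        funext k
        by_cases hk : ∃ t, eB t = k
        · obtain ⟨t, rfl⟩ := hk
          rw [eB.injective.extend_apply, hi]
        · rw [Function.extend_apply' _ _ _ hk]
      rw [this, A.sum_zero]
    rw [A.sumOver_eq (fun i => A.sumOver (fun j => x i j) _) _ (Function.Embedding.subtype _)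
      (fun i hi => ⟨⟨i, by
        by_contra hne
        push Not at hne
        exact hi ((h1 i).trans (h2 i hne))⟩, rfl⟩) eA]
    have h3 := A.sumOver_eq (fun k => x (π.symm k).1 (π.symm k).2)
      (Order.le_of_lt_succ (htot.trans_le hle))
      (((Function.Embedding.subtype _).prodMap (Function.Embedding.subtype _)).trans
        π.toEmbedding)
      (fun k hk => ⟨(⟨(π.symm k).1, _, hk⟩, ⟨(π.symm k).2, _, hk⟩), by simp⟩)
      ((eA.prodMap eB).trans p.toEmbedding)
    rw [h3]
    let z : CardIdx κ → CardIdx κ → H := fun i j =>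
      Function.extend eA (fun a => Function.extend eB (fun t => x a.1 t.1) (fun _ => A.zero) j)
        (fun _ => A.zero) i
    have hz1 : Function.extend eA
        (fun a => A.sumOver (fun j => x a.1 j)
          (Order.le_of_lt_succ ((hin a.1).trans_le hle))) (fun _ => A.zero) =
        fun i => A.sum (fun j => z i j) := by
      funext i
      by_cases hi : ∃ a, eA a = i
      · obtain ⟨a, rfl⟩ := hi
        simp only [z, eA.injective.extend_apply, h1]
      · rw [Function.extend_apply' _ _ _ hi]
        simp only [z, Function.extend_apply' _ _ _ hi, A.sum_zero]
    have hz2 : Function.extend ((eA.prodMap eB).trans p.toEmbedding)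
        (fun q => x (π.symm ((((Function.Embedding.subtype _).prodMap
          (Function.Embedding.subtype _)).trans π.toEmbedding) q)).1
          (π.symm ((((Function.Embedding.subtype _).prodMap
          (Function.Embedding.subtype _)).trans π.toEmbedding) q)).2) (fun _ => A.zero) =
        fun k => z (p.symm k).1 (p.symm k).2 := by
      funext k
      obtain ⟨⟨i, j⟩, rfl⟩ := p.surjective k
      simp only [Equiv.symm_apply_apply]
      by_cases hq : ∃ q, (eA.prodMap eB) q = (i, j)
      · obtain ⟨⟨a, t⟩, hq⟩ := hq
        obtain ⟨rfl, rfl⟩ := Prod.ext_iff.1 hq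
        have : p (eA a, eB t) = ((eA.prodMap eB).trans p.toEmbedding) (a, t) := rfl
        simp only [Function.Embedding.coe_prodMap, Prod.map_apply]
        rw [this, Function.Embedding.injective _ |>.extend_apply]
        simp [z, eA.injective.extend_apply, eB.injective.extend_apply]
      · rw [Function.extend_apply']
        · by_cases hi : ∃ a, eA a = i
          · obtain ⟨a, rfl⟩ := hi
            have hj : ¬ ∃ t, eB t = j := by
              rintro ⟨t, rfl⟩
              exact hq ⟨(a, t), rfl⟩
            simp only [z, eA.injective.extend_apply, Function.extend_apply' _ _ _ hj]
          · simp only [z, Function.extend_apply' _ _ _ hi]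
        · rintro ⟨q, h⟩
          exact hq ⟨q, p.injective h⟩
    exact (congrArg A.sum hz1).trans ((A.sum_flatten z p).trans (congrArg A.sum hz2.symm))

end KMonoid

/-- A commutative monoid is an `ℵ₀⁻`-monoid: families with finite support have a sum. -/
noncomputable def KMinusMonoid.ofAddCommMonoid (H : Type w) [AddCommMonoid H] :
    KMinusMonoid (ℵ₀ : Cardinal.{u}) H where
  isRegular := Cardinal.isRegular_aleph0
  zero := 0
  sum x _ := ∑ᶠ i, x i
  sum_trivial := by
    intro x _ i₀ _ h0
    exact finsum_eq_single x i₀ h0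
  sum_flatten := by
    intro x π hr hc hin hout htot
    have hfin : Set.Finite (Function.support fun q : CardIdx ℵ₀ × CardIdx ℵ₀ => x q.1 q.2) := by
      have hr' : Set.Finite {i | ∃ j, x i j ≠ 0} := Cardinal.lt_aleph0_iff_set_finite.1 hr
      have hc' : Set.Finite {j | ∃ i, x i j ≠ 0} := Cardinal.lt_aleph0_iff_set_finite.1 hc
      refine (hr'.prod hc').subset ?_
      rintro ⟨i, j⟩ h
      exact ⟨⟨j, h⟩, ⟨i, h⟩⟩
    rw [← finsum_curry (fun q : CardIdx ℵ₀ × CardIdx ℵ₀ => x q.1 q.2) hfin]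
    exact finsum_eq_of_bijective π π.bijective (fun q => by simp)

/-- Universal `κ`-extensions. Let `θ ≤ κ⁺` be regular, let `A` be a `θ⁻`-monoid structure on `H` and
`B` a `κ`-monoid structure on `E`. Then `B` is a universal `κ`-extension of `A` by means of
`ι : H → E` if `ι` is a `θ⁻`-homomorphism and every `θ⁻`-homomorphism from `H` to a `κ`-monoid `K`
factors through `ι` by a unique `κ`-homomorphism. -/
structure IsUniversalExtension {θ κ : Cardinal.{u}} (hle : θ ≤ Order.succ κ) {H : Type w}
    {E : Type w} (A : KMinusMonoid θ H) (B : KMonoid κ E) (ι : H → E) : Prop where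
  hom : IsKMinusHom A (B.toMinus θ A.isRegular hle) ι
  existsUnique : ∀ (K : Type w') (C : KMonoid κ K) (φ : H → K),
    IsKMinusHom A (C.toMinus θ A.isRegular hle) φ →
      ∃! ψ : E → K, IsKHom B C ψ ∧ ∀ h, φ h = ψ (ι h)

/-! ### Isomorphism classes of modules -/

section Modules

variable (S : Type u) [Ring S]

/-- The relation of being isomorphic, on `S`-modules. -/
def modIsoSetoid : Setoid (ModuleCat.{u} S) where
  r M N := Nonempty (M ≃ₗ[S] N)
  iseqv :=
    { refl := fun M => ⟨LinearEquiv.refl S M⟩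
      symm := fun ⟨e⟩ => ⟨e.symm⟩
      trans := fun ⟨e⟩ ⟨f⟩ => ⟨e.trans f⟩ }

/-- The isomorphism classes of `S`-modules. -/
def ModClass : Type (u + 1) := Quotient (modIsoSetoid S)

variable {S}

namespace ModClass

/-- The isomorphism class of a module. -/
def mk (M : Type u) [AddCommGroup M] [Module S M] : ModClass S :=
  Quotient.mk (modIsoSetoid S) (ModuleCat.of S M)

theorem mk_eq_mk {M N : Type u} [AddCommGroup M] [Module S M] [AddCommGroup N] [Module S N] :
    (mk M : ModClass S) = mk N ↔ Nonempty (M ≃ₗ[S] N) :=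
  ⟨fun h => Quotient.exact h, fun h => Quotient.sound (s := modIsoSetoid S) h⟩

/-- A representative of an isomorphism class. -/
noncomputable def rep (c : ModClass S) : ModuleCat.{u} S := Quotient.out c

theorem mk_rep (c : ModClass S) : mk c.rep = c := Quotient.out_eq c

variable (S) in
/-- The class of the zero module. -/
def zero : ModClass S := mk PUnit.{u + 1}

theorem mk_eq_zero {M : Type u} [AddCommGroup M] [Module S M] :
    (mk M : ModClass S) = zero S ↔ Subsingleton M := by
  refine mk_eq_mk.trans ⟨fun ⟨e⟩ => e.toEquiv.subsingleton, fun _ => ⟨?_⟩⟩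
  exact { toFun := fun _ => 0, invFun := fun _ => 0, map_add' := by simp, map_smul' := by simp
          left_inv := fun _ => Subsingleton.elim _ _, right_inv := fun _ => Subsingleton.elim _ _ }

/-- The class of a direct sum of modules, `⨁ [M i] = [⨁ M i]` (see `dsum_mk`). -/
noncomputable def dsum {I : Type u} (x : I → ModClass S) : ModClass S := mk (⨁ i, (x i).rep)

theorem dsum_mk {I : Type u} (M : I → Type u) [∀ i, AddCommGroup (M i)] [∀ i, Module S (M i)] :
    dsum (fun i => (mk (M i) : ModClass S)) = mk (⨁ i, M i) := by
  refine mk_eq_mk.2 ⟨DirectSum.congrLinearEquiv fun i => ?_⟩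
  exact (mk_eq_mk.1 (mk_rep (mk (M i)))).some

theorem dsum_single {I : Type u} (x : I → ModClass S) (i₀ : I)
    (h : ∀ i, i ≠ i₀ → x i = zero S) : dsum x = x i₀ := by
  classical
  conv_rhs => rw [← mk_rep (x i₀)]
  refine mk_eq_mk.2 ⟨LinearEquiv.ofBijective (DirectSum.component S I _ i₀) ⟨?_, ?_⟩⟩
  · intro a b hab
    refine DFinsupp.ext fun i => ?_
    by_cases hi : i = i₀
    · subst hi; exact hab
    · have : Subsingleton (x i).rep := by rw [← mk_eq_zero (S := S), mk_rep, h i hi]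
      exact Subsingleton.elim _ _
  · intro m
    exact ⟨DirectSum.lof S I _ i₀ m, DirectSum.component.lof_self S _ _⟩

theorem dsum_reindex {I J : Type u} (e : I ≃ J) (x : I → ModClass S) :
    dsum (fun j => x (e.symm j)) = dsum x :=
  mk_eq_mk.2 ⟨(DirectSum.lequivCongrLeft S (M := fun i => ((x i).rep : Type u)) e).symm⟩

theorem dsum_dsum {I J : Type u} (x : I → J → ModClass S) :
    dsum (fun i => dsum (fun j => x i j)) = dsum (fun q : I × J => x q.1 q.2) := by
  classical
  rw [← dsum_reindex (Equiv.sigmaEquivProd I J).symm]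
  refine (dsum_mk _).trans (mk_eq_mk.2 ⟨?_⟩)
  exact (DirectSum.sigmaLcurryEquiv S (δ := fun i j => (x i j).rep)).symm

/-- The class of a direct sum of two modules. -/
noncomputable def add (c d : ModClass S) : ModClass S := mk (c.rep × d.rep)

theorem add_mk (M N : Type u) [AddCommGroup M] [Module S M] [AddCommGroup N] [Module S N] :
    add (mk M : ModClass S) (mk N) = mk (M × N) :=
  mk_eq_mk.2 ⟨LinearEquiv.prodCongr (mk_eq_mk.1 (mk_rep (mk M))).some
    (mk_eq_mk.1 (mk_rep (mk N))).some⟩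

/-- The class consists of projective modules generated by at most `κ` elements. -/
def IsProjLE (κ : Cardinal.{u}) (c : ModClass S) : Prop :=
  Module.Projective S c.rep ∧ ∃ s : Set c.rep, #s ≤ κ ∧ Submodule.span S s = ⊤

/-- The class consists of projective modules generated by fewer than `θ` elements. -/
def IsProjLT (θ : Cardinal.{u}) (c : ModClass S) : Prop :=
  Module.Projective S c.rep ∧ ∃ s : Set c.rep, #s < θ ∧ Submodule.span S s = ⊤

/-- The class consists of finitely generated projective modules. -/
def IsProjFG (c : ModClass S) : Prop :=
  Module.Projective S c.rep ∧ Module.Finite S c.rep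

theorem isProjLE_mk {κ : Cardinal.{u}} {M : Type u} [AddCommGroup M] [Module S M] :
    IsProjLE κ (mk M : ModClass S) ↔
      Module.Projective S M ∧ ∃ s : Set M, #s ≤ κ ∧ Submodule.span S s = ⊤ := by
  obtain ⟨e⟩ := mk_eq_mk.1 (mk_rep (mk M : ModClass S))
  constructor
  · rintro ⟨h, s, hs, hs'⟩
    refine ⟨Module.Projective.of_equiv e, e '' s, Cardinal.mk_image_le.trans hs, ?_⟩
    have := Submodule.map_span e.toLinearMap s
    rw [hs', Submodule.map_top, LinearEquiv.range] at this
    exact this.symm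
  · rintro ⟨h, s, hs, hs'⟩
    refine ⟨Module.Projective.of_equiv e.symm, e.symm '' s, Cardinal.mk_image_le.trans hs, ?_⟩
    have := Submodule.map_span e.symm.toLinearMap s
    rw [hs', Submodule.map_top, LinearEquiv.range] at this
    exact this.symm

theorem isProjLT_mk {θ : Cardinal.{u}} {M : Type u} [AddCommGroup M] [Module S M] :
    IsProjLT θ (mk M : ModClass S) ↔
      Module.Projective S M ∧ ∃ s : Set M, #s < θ ∧ Submodule.span S s = ⊤ := by
  obtain ⟨e⟩ := mk_eq_mk.1 (mk_rep (mk M : ModClass S))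
  constructor
  · rintro ⟨h, s, hs, hs'⟩
    refine ⟨Module.Projective.of_equiv e, e '' s, Cardinal.mk_image_le.trans_lt hs, ?_⟩
    have := Submodule.map_span e.toLinearMap s
    rw [hs', Submodule.map_top, LinearEquiv.range] at this
    exact this.symm
  · rintro ⟨h, s, hs, hs'⟩
    refine ⟨Module.Projective.of_equiv e.symm, e.symm '' s, Cardinal.mk_image_le.trans_lt hs, ?_⟩
    have := Submodule.map_span e.symm.toLinearMap s
    rw [hs', Submodule.map_top, LinearEquiv.range] at this
    exact this.symm

theorem isProjFG_mk {M : Type u} [AddCommGroup M] [Module S M] :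
    IsProjFG (mk M : ModClass S) ↔ Module.Projective S M ∧ Module.Finite S M := by
  obtain ⟨e⟩ := mk_eq_mk.1 (mk_rep (mk M : ModClass S))
  constructor
  · rintro ⟨h, h'⟩
    exact ⟨Module.Projective.of_equiv e, Module.Finite.equiv e⟩
  · rintro ⟨h, h'⟩
    exact ⟨Module.Projective.of_equiv e.symm, Module.Finite.equiv e.symm⟩

theorem span_iUnion_lof {I : Type u} [DecidableEq I] (M : I → Type u) [∀ i, AddCommGroup (M i)]
    [∀ i, Module S (M i)] (s : ∀ i, Set (M i)) (hs : ∀ i, Submodule.span S (s i) = ⊤) :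
    Submodule.span S (⋃ i, DirectSum.lof S I M i '' s i) = ⊤ := by
  rw [Submodule.span_iUnion]
  simp_rw [Submodule.span_image, hs, Submodule.map_top]
  exact DFinsupp.iSup_range_lsingle

theorem IsProjLE.zero (κ : Cardinal.{u}) : IsProjLE κ (ModClass.zero S) :=
  isProjLE_mk.2 ⟨inferInstance, ∅, by simp, Subsingleton.elim _ _⟩

theorem IsProjLT.zero {θ : Cardinal.{u}} (hθ : 0 < θ) : IsProjLT θ (ModClass.zero S) :=
  isProjLT_mk.2 ⟨inferInstance, ∅, by simpa using hθ, Subsingleton.elim _ _⟩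

theorem IsProjFG.zero : IsProjFG (ModClass.zero S) :=
  isProjFG_mk.2 ⟨inferInstance, inferInstance⟩

theorem IsProjFG.add {c d : ModClass S} (hc : IsProjFG c) (hd : IsProjFG d) :
    IsProjFG (ModClass.add c d) := by
  have := hc.1
  have := hc.2
  have := hd.1
  have := hd.2
  exact isProjFG_mk.2 ⟨inferInstance, inferInstance⟩

theorem IsProjLE.dsum {κ : Cardinal.{u}} (hκ : ℵ₀ ≤ κ) {I : Type u} (hI : #I ≤ κ)
    {x : I → ModClass S} (hx : ∀ i, IsProjLE κ (x i)) : IsProjLE κ (ModClass.dsum x) := by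
  classical
  have := fun i => (hx i).1
  choose s hs hs' using fun i => (hx i).2
  refine isProjLE_mk.2 ⟨inferInstance, _, ?_, span_iUnion_lof _ s hs'⟩
  refine (Cardinal.mk_iUnion_le _).trans ?_
  refine (mul_le_mul' hI (ciSup_le' fun i => Cardinal.mk_image_le.trans (hs i))).trans ?_
  exact (Cardinal.mul_eq_self hκ).le

theorem IsProjLT.dsum {θ : Cardinal.{u}} (hθ : θ.IsRegular) {I : Type u}
    {x : I → ModClass S} (hx : ∀ i, IsProjLT θ (x i)) (hI : #{i // x i ≠ ModClass.zero S} < θ) :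
    IsProjLT θ (ModClass.dsum x) := by
  classical
  have := fun i => (hx i).1
  have h : ∀ i, ∃ s : Set (x i).rep, #s < θ ∧ Submodule.span S s = ⊤ ∧
      (x i = ModClass.zero S → s = ∅) := by
    intro i
    by_cases h0 : x i = ModClass.zero S
    · have : Subsingleton (x i).rep := by rw [← mk_eq_zero (S := S), mk_rep, h0]
      exact ⟨∅, by simpa using hθ.pos, Subsingleton.elim _ _, fun _ => rfl⟩
    · obtain ⟨s, hs, hs'⟩ := (hx i).2
      exact ⟨s, hs, hs', fun h => (h0 h).elim⟩
  choose s hs hs' hs0 using h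
  refine isProjLT_mk.2 ⟨inferInstance, _, ?_, span_iUnion_lof _ s hs'⟩
  have hU : (⋃ i, DirectSum.lof S I (fun i => (x i).rep) i '' s i) =
      ⋃ i : {i // x i ≠ ModClass.zero S},
        DirectSum.lof S I (fun i => (x i).rep) i.1 '' s i.1 := by
    ext m
    simp only [Set.mem_iUnion]
    constructor
    · rintro ⟨i, hi⟩
      refine ⟨⟨i, fun h0 => ?_⟩, hi⟩
      simp [hs0 i h0] at hi
    · rintro ⟨i, hi⟩
      exact ⟨i.1, hi⟩
  rw [hU, Cardinal.card_iUnion_lt_iff_forall_of_isRegular hθ hI]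
  exact fun i => Cardinal.mk_image_le.trans_lt (hs i.1)

end ModClass

end Modules

/-! ### The monoids of projective right modules

Right `R`-modules are modules over the opposite ring `Rᵐᵒᵖ`. -/

section Projective

variable (R : Type u) [Ring R]

/-- The set of isomorphism classes of projective right `R`-modules generated by at most `κ`
elements. -/
def VKappa (κ : Cardinal.{u}) : Type (u + 1) :=
  {c : ModClass Rᵐᵒᵖ // c.IsProjLE κ}

/-- The `κ`-monoid `V^κ(R)`, with `Σ [P i] = [⨁ P i]`. -/
noncomputable def vKappa (κ : Cardinal.{u}) (hκ : ℵ₀ ≤ κ) : KMonoid κ (VKappa R κ) where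
  aleph0_le := hκ
  zero := ⟨ModClass.zero _, .zero κ⟩
  sum x := ⟨ModClass.dsum fun i => (x i).1,
    .dsum hκ (by rw [Cardinal.mk_toType, Cardinal.card_ord]) fun i => (x i).2⟩
  sum_trivial x i₀ _ h0 := Subtype.ext <|
    ModClass.dsum_single _ i₀ fun i hi => congrArg Subtype.val (h0 i hi)
  sum_flatten x π := Subtype.ext <|
    (ModClass.dsum_dsum fun i j => (x i j).1).trans
      (ModClass.dsum_reindex π fun q : CardIdx κ × CardIdx κ => (x q.1 q.2).1).symm

/-- The set of isomorphism classes of projective right `R`-modules generated by fewer than `θ`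
elements. -/
def VMinus (θ : Cardinal.{u}) : Type (u + 1) :=
  {c : ModClass Rᵐᵒᵖ // c.IsProjLT θ}

/-- The `θ⁻`-monoid `V^{θ⁻}(R)`, with `Σ [P i] = [⨁ P i]`. -/
noncomputable def vMinus (θ : Cardinal.{u}) (hθ : θ.IsRegular) : KMinusMonoid θ (VMinus R θ) where
  isRegular := hθ
  zero := ⟨ModClass.zero _, .zero hθ.pos⟩
  sum x hx := ⟨ModClass.dsum fun i => (x i).1, .dsum hθ (fun i => (x i).2) (by
    convert hx using 5
    exact ⟨fun h => Subtype.ext h, fun h => congrArg Subtype.val h⟩)⟩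
  sum_trivial x _ i₀ _ h0 := Subtype.ext <|
    ModClass.dsum_single _ i₀ fun i hi => congrArg Subtype.val (h0 i hi)
  sum_flatten x π _ _ _ _ _ := Subtype.ext <|
    (ModClass.dsum_dsum fun i j => (x i j).1).trans
      (ModClass.dsum_reindex π fun q : CardIdx θ × CardIdx θ => (x q.1 q.2).1).symm

/-- The set `V(R)` of isomorphism classes of finitely generated projective right `R`-modules. -/
def VFin : Type (u + 1) :=
  {c : ModClass Rᵐᵒᵖ // c.IsProjFG}

noncomputable instance : Zero (VFin R) := ⟨⟨ModClass.zero _, .zero⟩⟩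

noncomputable instance : Add (VFin R) := ⟨fun c d => ⟨ModClass.add c.1 d.1, .add c.2 d.2⟩⟩

/-- The commutative monoid `V(R)`, with `[P] + [Q] = [P ⊕ Q]`. -/
noncomputable instance : AddCommMonoid (VFin R) where
  nsmul := nsmulRec
  add_assoc := by
    rintro ⟨a, ha⟩ ⟨b, hb⟩ ⟨c, hc⟩
    refine Subtype.ext (?_ : ModClass.add (ModClass.add a b) c = ModClass.add a (ModClass.add b c))
    conv_lhs => rw [← ModClass.mk_rep c]
    conv_rhs => rw [← ModClass.mk_rep a]
    unfold ModClass.add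
    exact (ModClass.add_mk _ _).trans ((ModClass.mk_eq_mk.2 ⟨LinearEquiv.prodAssoc _ _ _ _⟩).trans
      (ModClass.add_mk _ _).symm)
  zero_add := by
    rintro ⟨a, ha⟩
    refine Subtype.ext (?_ : ModClass.add (ModClass.zero _) a = a)
    conv_lhs => rw [← ModClass.mk_rep a]
    conv_rhs => rw [← ModClass.mk_rep a]
    exact (ModClass.add_mk _ _).trans (ModClass.mk_eq_mk.2 ⟨LinearEquiv.uniqueProd⟩)
  add_zero := by
    rintro ⟨a, ha⟩
    refine Subtype.ext (?_ : ModClass.add a (ModClass.zero _) = a)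
    conv_lhs => rw [← ModClass.mk_rep a]
    conv_rhs => rw [← ModClass.mk_rep a]
    exact (ModClass.add_mk _ _).trans (ModClass.mk_eq_mk.2 ⟨LinearEquiv.prodUnique⟩)
  add_comm := by
    rintro ⟨a, ha⟩ ⟨b, hb⟩
    exact Subtype.ext (ModClass.mk_eq_mk.2 ⟨LinearEquiv.prodComm _ _ _⟩)

variable {R}

/-- The inclusion of `V^{θ⁻}(R)` into `V^κ(R)`, for `θ ≤ κ⁺`. -/
def VMinus.incl {θ κ : Cardinal.{u}} (hle : θ ≤ Order.succ κ) (c : VMinus R θ) : VKappa R κ :=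
  ⟨c.1, c.2.1, c.2.2.imp fun _ h => ⟨Order.le_of_lt_succ (h.1.trans_le hle), h.2⟩⟩

/-- The inclusion of `V^α(R)` into `V^κ(R)`, for `α ≤ κ`. -/
def VKappa.incl {α κ : Cardinal.{u}} (hle : α ≤ κ) (c : VKappa R α) : VKappa R κ :=
  ⟨c.1, c.2.1, c.2.2.imp fun _ h => ⟨h.1.trans hle, h.2⟩⟩

/-- The inclusion of `V(R)` into `V^κ(R)`. -/
def VFin.incl {κ : Cardinal.{u}} (hκ : ℵ₀ ≤ κ) (c : VFin R) : VKappa R κ :=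
  ⟨c.1, c.2.1, by
    obtain ⟨s, hs⟩ := c.2.2.fg_top
    exact ⟨s, (Cardinal.lt_aleph0_of_finite _).le.trans hκ, hs⟩⟩

end Projective

/-! Universality splits into two facts (`isUniversalExtension_of_sum`): every class in $V^\kappa(R)$
is a $\kappa$-sum of classes from the smaller monoid, and any homomorphism $\varphi$ into a
$\kappa$-monoid takes the same value on any two such presentations of a class. The first fact is
Kaplansky's theorem in parts 1 and 2, and the hypothesis on $R$ in part 3. The second concerns an
isomorphism $e\colon\bigoplus_I P_i\cong\bigoplus_J Q_j$.

If all summands have fewer than $\theta$ generators, with $\theta$ regular and uncountable, call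
$W\subseteq I\sqcup J$ closed if it contains all indices that $e$ and $e^{-1}$ reach from generators
of summands indexed in $W$. Then $e$ identifies the partial sums over $W\cap I$ and $W\cap J$. A
well-ordered filtration of $I\sqcup J$ by closed sets with steps smaller than $\theta$ cuts both
sums into matching isomorphic blocks (`exists_block_decomposition`). Each block is a sum inside the
small monoid, so $\varphi$ respects it; associativity in the target does the rest.

For finitely generated summands this argument with $\theta=\aleph_1$ leaves countable blocks. There
finite sets $F_n\subseteq I$ and $G_n\subseteq J$ are interleaved so that the partial sums form one
chain $F_0\le G_0\le F_1\le G_1\le\dots$ in a single module. With $D_n$ its successive complements,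
the blocks on one side are $D_{2n}\oplus D_{2n+1}$ and on the other $D_{2n+1}\oplus D_{2n+2}$, where
$D_0=0$ (`exists_zigzag`). Both sides are therefore bracketings of $\sum_n\varphi[D_n]$.

Closed sets also give Kaplansky's theorem: a free cover $f$ with section $g$ and closure under the
supports of $gf$ yield a chain of idempotents on the projective module whose layers are countably
generated. -/

namespace KMonoid

variable {κ : Cardinal.{u}} {H : Type w}

/-! ### Sums over arbitrary index sets in a κ-monoid -/

open Classical in
/-- The sum of a family over any index set that embeds into `κ` (and `0` for larger index sets). -/
noncomputable def tot (A : KMonoid κ H) {J : Type*} (x : J → H) : H :=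
  if h : Nonempty (J ↪ CardIdx κ) then A.sum (Function.extend h.some x fun _ => A.zero)
  else A.zero

theorem tot_eq (A : KMonoid κ H) {J : Type*} (x : J → H) (e : J ↪ CardIdx κ) :
    A.tot x = A.sum (Function.extend e x fun _ => A.zero) := by
  have h : Nonempty (J ↪ CardIdx κ) := ⟨e⟩
  rw [tot, dif_pos h]
  -- `J` may live in any universe, while `sum_extend_eq` needs an index set in `Type u`. The range
  -- of `e` in `CardIdx κ` serves as a copy of `J` there.
  have key : ∀ f : J ↪ CardIdx κ, Function.extend f x (fun _ => A.zero) =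
      Function.extend ((Equiv.ofInjective e e.injective).symm.toEmbedding.trans f)
        (fun t => x ((Equiv.ofInjective e e.injective).symm t)) (fun _ => A.zero) := by
    intro f
    funext k
    by_cases hk : ∃ j, f j = k
    · obtain ⟨j, rfl⟩ := hk
      have : f j = ((Equiv.ofInjective e e.injective).symm.toEmbedding.trans f)
          (Equiv.ofInjective e e.injective j) := by simp
      rw [f.injective.extend_apply, this, (Function.Embedding.injective _).extend_apply]
      simp
    · rw [Function.extend_apply' _ _ _ hk, Function.extend_apply']
      rintro ⟨t, ht⟩
      exact hk ⟨_, ht⟩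
  rw [key, key e]
  exact A.sum_extend_eq _ _ _

theorem tot_cardIdx (A : KMonoid κ H) (x : CardIdx κ → H) : A.tot x = A.sum x := by
  rw [A.tot_eq x (Function.Embedding.refl _)]
  congr 1
  funext k
  exact (Function.Embedding.injective (Function.Embedding.refl (CardIdx κ))).extend_apply x _ k

theorem tot_comp_embedding (A : KMonoid κ H) {J L : Type*} (x : J → H)
    (hJ : Nonempty (J ↪ CardIdx κ)) (l : L ↪ J) (hl : ∀ j, x j ≠ A.zero → j ∈ Set.range l) :
    A.tot (fun t => x (l t)) = A.tot x := by
  obtain ⟨e⟩ := hJ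
  rw [A.tot_eq x e, A.tot_eq _ (l.trans e)]
  congr 1
  funext k
  by_cases hk : ∃ j, e j = k
  · obtain ⟨j, rfl⟩ := hk
    rw [e.injective.extend_apply]
    by_cases hj : j ∈ Set.range l
    · obtain ⟨t, rfl⟩ := hj
      exact (l.trans e).injective.extend_apply _ _ t
    · rw [Function.extend_apply']
      · exact (not_not.1 (mt (hl j) hj)).symm
      · rintro ⟨t, ht⟩
        exact hj ⟨t, e.injective ht⟩
  · rw [Function.extend_apply' _ _ _ hk, Function.extend_apply']
    rintro ⟨t, ht⟩
    exact hk ⟨_, ht⟩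

theorem tot_equiv (A : KMonoid κ H) {J L : Type*} (x : J → H)
    (hJ : Nonempty (J ↪ CardIdx κ)) (l : L ≃ J) :
    A.tot (fun t => x (l t)) = A.tot x :=
  A.tot_comp_embedding x hJ l.toEmbedding fun j _ => ⟨l.symm j, l.apply_symm_apply j⟩

/-- Embedding the base and every fibre into `κ` places the total space in the square `κ × κ`, one
fibre per row. The family extended by zero is then summed by rows with `sum_flatten`. -/
theorem tot_sigma (A : KMonoid κ H) {T : Type*} {F : T → Type*}
    (hT : Nonempty (T ↪ CardIdx κ)) (hF : ∀ t, Nonempty (F t ↪ CardIdx κ))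
    (x : (Σ t, F t) → H) : A.tot x = A.tot fun t => A.tot fun j => x ⟨t, j⟩ := by
  classical
  obtain ⟨p⟩ := A.exists_prodEquiv
  obtain ⟨e⟩ := hT
  have f : ∀ t, F t ↪ CardIdx κ := fun t => (hF t).some
  let g : (Σ t, F t) ↪ CardIdx κ × CardIdx κ :=
    ⟨fun q => (e q.1, f q.1 q.2), by
      rintro ⟨t, j⟩ ⟨t', j'⟩ h
      obtain rfl : t = t' := e.injective (congrArg Prod.fst h)
      obtain rfl : j = j' := (f t).injective (congrArg Prod.snd h)
      rfl⟩
  let z : CardIdx κ → CardIdx κ → H := fun i j => Function.extend g x (fun _ => A.zero) (i, j)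
  have hz : (Function.extend e (fun t => A.tot fun j => x ⟨t, j⟩) fun _ => A.zero) =
      fun i => A.sum fun j => z i j := by
    funext i
    by_cases hi : ∃ t, e t = i
    · obtain ⟨t, rfl⟩ := hi
      rw [e.injective.extend_apply, A.tot_eq _ (f t)]
      congr 1
      funext k
      by_cases hk : ∃ j, f t j = k
      · obtain ⟨j, rfl⟩ := hk
        rw [(f t).injective.extend_apply]
        exact (g.injective.extend_apply x _ ⟨t, j⟩).symm
      · rw [Function.extend_apply' _ _ _ hk]
        refine (Function.extend_apply' x (fun _ => A.zero) (e t, k) ?_).symm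
        rintro ⟨⟨t', j⟩, h⟩
        obtain rfl : t' = t := e.injective (congrArg Prod.fst h)
        exact hk ⟨j, congrArg Prod.snd h⟩
    · rw [Function.extend_apply' _ _ _ hi]
      have : (fun j => z i j) = fun _ => A.zero := by
        funext j
        refine Function.extend_apply' _ _ _ ?_
        rintro ⟨q, h⟩
        exact hi ⟨q.1, congrArg Prod.fst h⟩
      rw [this, A.sum_zero]
  rw [A.tot_eq _ e, hz, A.sum_flatten z p, A.tot_eq x (g.trans p.toEmbedding)]
  congr 1
  funext k
  by_cases hk : ∃ q, (g.trans p.toEmbedding) q = k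
  · obtain ⟨q, rfl⟩ := hk
    rw [(Function.Embedding.injective _).extend_apply]
    have : p.symm ((g.trans p.toEmbedding) q) = g q := by simp
    simp only [z, this]
    exact (g.injective.extend_apply x _ q).symm
  · rw [Function.extend_apply' _ _ _ hk]
    refine (Function.extend_apply' x (fun _ => A.zero) (p.symm k) ?_).symm
    rintro ⟨q, h⟩
    exact hk ⟨q, by simp [h]⟩

/-- The form in which associativity is used later: `a` assigns each summand to its block. -/
theorem tot_fiber (A : KMonoid κ H) {J T : Type*} (hJ : Nonempty (J ↪ CardIdx κ))
    (hT : Nonempty (T ↪ CardIdx κ)) (a : J → T) (x : J → H) :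
    A.tot x = A.tot fun t => A.tot fun j : {j // a j = t} => x j := by
  rw [← A.tot_equiv x hJ (Equiv.sigmaFiberEquiv a)]
  refine A.tot_sigma hT (fun t => ?_) _
  exact ⟨(Function.Embedding.subtype _).trans hJ.some⟩

theorem nonempty_embedding_of_countable (A : KMonoid κ H) (J : Type*) [Countable J] :
    Nonempty (J ↪ CardIdx κ) := by
  have := A.infinite
  obtain ⟨f, hf⟩ := exists_injective_nat J
  exact ⟨(⟨f, hf⟩ : J ↪ ℕ).trans (Infinite.natEmbedding _)⟩

theorem sumOver_eq_tot (A : KMonoid κ H) {J : Type u} (x : J → H)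
    (hx : #{j // x j ≠ A.zero} ≤ κ) {L : Type u} (l : L ↪ J)
    (hl : ∀ j, x j ≠ A.zero → j ∈ Set.range l) (hL : Nonempty (L ↪ CardIdx κ)) :
    A.sumOver x hx = A.tot fun t => x (l t) := by
  obtain ⟨e⟩ := hL
  rw [A.sumOver_eq x hx l hl e, A.tot_eq _ e]

theorem sumOver_eq_tot_support (A : KMonoid κ H) {J : Type u} (x : J → H)
    (hx : #{j // x j ≠ A.zero} ≤ κ) :
    A.sumOver x hx = A.tot fun t : {j // x j ≠ A.zero} => x t :=
  A.sumOver_eq_tot x hx (Function.Embedding.subtype _) (fun j hj => ⟨⟨j, hj⟩, rfl⟩)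
    (exists_embedding hx)

end KMonoid

/-! ### Homomorphisms and the criterion for universality -/

/-- Extending a family indexed by `J` along an embedding into `CardIdx θ` and summing with a
`θ⁻`-homomorphism into a `κ`-monoid. -/
theorem IsKMinusHom.map_sum_extend {θ κ : Cardinal.{u}} {hle : θ ≤ Order.succ κ} {H : Type w}
    {A : KMinusMonoid θ H} {K : Type w'} {C : KMonoid κ K} {φ : H → K}
    (hφ : IsKMinusHom A (C.toMinus θ A.isRegular hle) φ) {J : Type u} (y : J → H)
    (hJ : #J < θ) (e : J ↪ CardIdx θ)
    (hx : #{i // Function.extend e y (fun _ => A.zero) i ≠ A.zero} < θ) :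
    φ (A.sum (Function.extend e y fun _ => A.zero) hx) = C.tot fun j => φ (y j) := by
  have h0 : φ A.zero = C.zero := hφ.map_zero
  have hsupp : ∀ i, φ (Function.extend e y (fun _ => A.zero) i) ≠ C.zero → i ∈ Set.range e := by
    intro i hi
    by_contra h
    exact hi ((congrArg φ (Function.extend_apply' _ _ _ h)).trans h0)
  have hx' : #{i // φ (Function.extend e y (fun _ => A.zero) i) ≠ C.zero} < θ :=
    (Cardinal.mk_subtype_le_of_subset fun i hi h => hi ((congrArg φ h).trans h0)).trans_lt hx
  refine (hφ.map_sum _ hx hx').trans ?_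
  refine (C.sumOver_eq_tot _ (Order.le_of_lt_succ (hx'.trans_le hle)) e hsupp
    (KMonoid.exists_embedding (Order.le_of_lt_succ (hJ.trans_le hle)))).trans ?_
  simp only [e.injective.extend_apply]

/-- A criterion for universality: every element of the extension is a sum of elements of the
`θ⁻`-monoid, and equalities between such sums are respected by homomorphisms. -/
theorem isUniversalExtension_of_sum {θ κ : Cardinal.{u}} {hle : θ ≤ Order.succ κ} {H E : Type w}
    {A : KMinusMonoid θ H} {B : KMonoid κ E} {ι : H → E}
    (hom : IsKMinusHom A (B.toMinus θ A.isRegular hle) ι)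
    (gen : ∀ e, ∃ c : CardIdx κ → H, B.sum (fun i => ι (c i)) = e)
    (indep : ∀ (K : Type w') (C : KMonoid κ K) (φ : H → K),
      IsKMinusHom A (C.toMinus θ A.isRegular hle) φ → ∀ c c' : CardIdx κ → H,
        B.sum (fun i => ι (c i)) = B.sum (fun i => ι (c' i)) →
          C.sum (fun i => φ (c i)) = C.sum (fun i => φ (c' i))) :
    IsUniversalExtension.{u, w, w'} hle A B ι := by
  classical
  refine ⟨hom, fun K C φ hφ => ?_⟩
  have hι0 : ι A.zero = B.zero := hom.map_zero
  have hφ0 : φ A.zero = C.zero := hφ.map_zero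
  choose r hr using gen
  obtain ⟨p⟩ := B.exists_prodEquiv
  obtain ⟨b, hb⟩ := B.exists_bot
  -- The element `h` alone, placed at the least index, is another presentation of `ι h`, so `indep`
  -- compares it with the chosen one.
  have single : ∀ h : H, φ h = C.sum fun i => φ (r (ι h) i) := by
    intro h
    let c : CardIdx κ → H := fun i => if i = b then h else A.zero
    have h1 : B.sum (fun i => ι (c i)) = ι h := by
      rw [B.sum_trivial _ b hb fun i hi => by simp [c, hi, hι0]]
      simp [c]
    have h2 : C.sum (fun i => φ (c i)) = φ h := by
      rw [C.sum_trivial _ b hb fun i hi => by simp [c, hi, hφ0]]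
      simp [c]
    rw [← h2]
    exact indep K C φ hφ _ _ (h1.trans (hr _).symm)
  refine ⟨fun e => C.sum fun i => φ (r e i), ⟨⟨?_, fun x => ?_⟩, single⟩, ?_⟩
  · rw [← hι0, ← hφ0]
    exact (single A.zero).symm
  -- Concatenating the chosen presentations of the `x i` gives a presentation of their sum, to be
  -- compared with the chosen one.
  · refine Eq.trans ?_ (C.sum_flatten (fun i j => φ (r (x i) j)) p).symm
    refine indep K C φ hφ _ (fun k => r (x (p.symm k).1) (p.symm k).2) ?_
    rw [hr]
    refine Eq.trans ?_ (B.sum_flatten (fun i j => ι (r (x i) j)) p)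
    simp only [hr]
  · rintro ψ ⟨hψ, hψι⟩
    funext e
    conv_lhs => rw [← hr e]
    rw [hψ.map_sum]
    simp only [hψι]

/-! ### Filtrations by closed sets -/

/-- For a regular uncountable `θ`, each element lies in a subset of cardinality `< θ` which is
closed under a set-valued function with values of cardinality `< θ`. -/
theorem exists_closed_subset {X : Type u} {θ : Cardinal.{u}} (hθ : θ.IsRegular) (h1 : ℵ₀ < θ)
    (f : X → Set X) (hf : ∀ x, #(f x) < θ) (x : X) :
    ∃ C : Set X, x ∈ C ∧ #C < θ ∧ ∀ y ∈ C, f y ⊆ C := by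
  -- Countably many iterations suffice for closure. Regularity of `θ` bounds each stage, and
  -- uncountability bounds their union.
  let L : ℕ → Set X := fun n => Nat.rec {x} (fun _ s => ⋃ y : s, f y) n
  have hL : ∀ n, #(↥(L n)) < θ := by
    intro n
    induction n with
    | zero =>
      change #({x} : Set X) < θ
      rw [Cardinal.mk_singleton]
      exact one_lt_aleph0.trans h1
    | succ n ih =>
      exact (Cardinal.card_iUnion_lt_iff_forall_of_isRegular hθ ih).2 fun y => hf y.1
  refine ⟨⋃ n : ULift.{u} ℕ, L n.down, Set.mem_iUnion.2 ⟨⟨0⟩, rfl⟩, ?_, fun y hy => ?_⟩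
  · rw [Cardinal.card_iUnion_lt_iff_forall_of_isRegular hθ (by simpa using h1)]
    exact fun n => hL n.down
  · obtain ⟨n, hn⟩ := Set.mem_iUnion.1 hy
    refine Set.subset_iUnion_of_subset ⟨n.down + 1⟩ ?_
    exact Set.subset_iUnion_of_subset (⟨y, hn⟩ : L n.down) le_rfl

/-- A filtration of a set by subsets which are closed under a set-valued function `f` with values of
cardinality `< θ`, such that the steps `V t \ U t` of the filtration have cardinality `< θ`. -/
structure ClosedFiltration {X : Type u} [LinearOrder X] (f : X → Set X) (θ : Cardinal.{u}) where
  U : X → Set X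
  V : X → Set X
  closed_U : ∀ t, ∀ x ∈ U t, f x ⊆ U t
  closed_V : ∀ t, ∀ x ∈ V t, f x ⊆ V t
  U_subset_V : ∀ t, U t ⊆ V t
  V_subset_U : ∀ s t, s < t → V s ⊆ U t
  exists_of_mem_U : ∀ t, ∀ x ∈ U t, ∃ s < t, x ∈ V s
  mem_V : ∀ x, x ∈ V x
  card_lt : ∀ t, #(V t \ U t : Set X) < θ

theorem ClosedFiltration.nonempty {X : Type u} [LinearOrder X] {θ : Cardinal.{u}}
    (hθ : θ.IsRegular) (h1 : ℵ₀ < θ) (f : X → Set X) (hf : ∀ x, #(f x) < θ) :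
    Nonempty (ClosedFiltration f θ) := by
  choose C hC hcard hcl using exists_closed_subset hθ h1 f hf
  -- The step from `U t` to `V t` adds at most the small closed set `C t`, whence the bound on its
  -- size.
  refine ⟨⟨fun t => {x | ∃ s < t, x ∈ C s}, fun t => {x | ∃ s ≤ t, x ∈ C s}, ?_, ?_, ?_, ?_, ?_, ?_,
    ?_⟩⟩
  · rintro t x ⟨s, hs, hx⟩ y hy
    exact ⟨s, hs, hcl s x hx hy⟩
  · rintro t x ⟨s, hs, hx⟩ y hy
    exact ⟨s, hs, hcl s x hx hy⟩
  · rintro t x ⟨s, hs, hx⟩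
    exact ⟨s, hs.le, hx⟩
  · rintro s t hst x ⟨r, hr, hx⟩
    exact ⟨r, hr.trans_lt hst, hx⟩
  · rintro t x ⟨s, hs, hx⟩
    exact ⟨s, hs, s, le_rfl, hx⟩
  · exact fun x => ⟨x, le_rfl, hC x⟩
  · refine fun t => (Cardinal.mk_le_mk_of_subset ?_).trans_lt (hcard t)
    rintro x ⟨⟨s, hs, hx⟩, hn⟩
    obtain rfl | h := hs.eq_or_lt
    · exact hx
    · exact (hn ⟨s, h, hx⟩).elim

namespace ClosedFiltration

variable {X : Type u} [LinearOrder X] {f : X → Set X} {θ : Cardinal.{u}}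
  (F : ClosedFiltration f θ)

theorem V_mono {s t : X} (h : s ≤ t) : F.V s ⊆ F.V t := by
  obtain rfl | h := h.eq_or_lt
  · exact le_rfl
  · exact (F.V_subset_U s t h).trans (F.U_subset_V t)

/-- Continuity of the filtration, for finite supports: each element appears at some earlier stage,
and the latest of finitely many stages contains them all. Nonemptiness is needed because there may
be no earlier stage. -/
theorem exists_finset_subset_V (t : X) (A : Finset X) (hA : A.Nonempty) (h : ∀ x ∈ A, x ∈ F.U t) :
    ∃ s < t, ∀ x ∈ A, x ∈ F.V s := by
  choose! s hs hs' using fun x hx => F.exists_of_mem_U t x (h x hx)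
  obtain ⟨a, ha, hmax⟩ := A.exists_max_image s hA
  exact ⟨s a, hs a ha, fun x hx => F.V_mono (hmax x hx) (hs' x hx)⟩

/-- The steps partition `X`: an element belongs to the step at the least `t` with `x ∈ V t`. -/
theorem exists_step [WellFoundedLT X] : ∃ c : X → X, ∀ x t, c x = t ↔ x ∈ F.V t \ F.U t := by
  have h : ∀ x, ∃ t, x ∈ F.V t \ F.U t := by
    intro x
    obtain ⟨t, ht, hmin⟩ := WellFounded.has_min (wellFounded_lt (α := X)) {t | x ∈ F.V t}
      ⟨x, F.mem_V x⟩
    refine ⟨t, ht, fun hU => ?_⟩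
    obtain ⟨s, hs, hx⟩ := F.exists_of_mem_U t x hU
    exact hmin s hx hs
  choose c hc using h
  refine ⟨c, fun x t => ⟨fun h => h ▸ hc x, fun h => ?_⟩⟩
  rcases lt_trichotomy (c x) t with hlt | heq | hgt
  · exact (h.2 (F.V_subset_U _ _ hlt (hc x).1)).elim
  · exact heq
  · exact ((hc x).2 (F.V_subset_U _ _ hgt h.1)).elim

end ClosedFiltration

/-! ### Layers between idempotents -/

section Layers

variable {S : Type*} [Ring S] {M N : Type*} [AddCommGroup M] [Module S M] [AddCommGroup N]
  [Module S N]

/-- For idempotents `p`, `q` with `range p ≤ range q`, a complement of `range p` in `range q`. -/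
def layer (p q : Module.End S M) : Submodule S M := LinearMap.range q ⊓ LinearMap.ker p

theorem mem_layer {p q : Module.End S M} (hq : ∀ x, q (q x) = q x) {x : M} :
    x ∈ layer p q ↔ q x = x ∧ p x = 0 := by
  refine ⟨?_, fun h => ⟨⟨x, h.1⟩, h.2⟩⟩
  rintro ⟨⟨y, rfl⟩, h⟩
  exact ⟨hq y, h⟩

/-- The map `q - p ∘ q` is a retraction of `M` onto the layer. -/
theorem projective_layer [Module.Projective S M] {p q : Module.End S M}
    (hp : ∀ x, p (p x) = p x) (hq : ∀ x, q (q x) = q x) (hpq : ∀ x, q (p x) = p x) :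
    Module.Projective S (layer p q) := by
  refine Module.Projective.of_split (layer p q).subtype
    ((q - p ∘ₗ q).codRestrict _ fun x => (mem_layer hq).2 ?_) (LinearMap.ext fun x => ?_)
  · simp [hp, hq, hpq]
  · have := (mem_layer hq).1 x.2
    ext
    simp [this]

/-- Layers are additive. -/
def layerProdEquiv {p q r : Module.End S M} (hp : ∀ x, p (p x) = p x) (hq : ∀ x, q (q x) = q x)
    (hr : ∀ x, r (r x) = r x) (hpq : ∀ x, q (p x) = p x) (hqr : ∀ x, r (q x) = q x) :
    layer p r ≃ₗ[S] layer p q × layer q r where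
  -- Only the ranges of the idempotents are nested, not their kernels, so `q x` need not lie in the
  -- kernel of `p`. Hence the corrections by `p` here and in the inverse.
  toFun x := (⟨q x - p (q x), by rw [mem_layer hq]; simp [hq, hp, hpq]⟩,
    ⟨x - q x, by
      have := (mem_layer hr).1 x.2
      rw [mem_layer hr]; simp [hq, hqr, this]⟩)
  map_add' x y := by
    ext <;> simp <;> abel
  map_smul' c x := by
    ext <;> simp [smul_sub]
  invFun y := ⟨y.1 + y.2 - p y.2, by
    have h1 := (mem_layer hq).1 y.1.2
    have h2 := (mem_layer hr).1 y.2.2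
    have h3 : r y.1 = y.1 := by rw [← h1.1, hqr]
    have h4 : ∀ x, r (p x) = p x := fun x => by rw [← hpq, hqr]
    rw [mem_layer hr]
    simp [h1, h2, h3, h4, hp]⟩
  left_inv x := by
    have h := (mem_layer hr).1 x.2
    ext
    simp [h.2]
  right_inv y := by
    have h1 := (mem_layer hq).1 y.1.2
    have h2 := (mem_layer hr).1 y.2.2
    ext <;> simp [h1, h2, hp, hpq]

/-- A layer depends only on the ranges of the idempotents, up to isomorphism. -/
def layerCongr {p q p' q' : Module.End S M} (hp : ∀ x, p (p x) = p x) (hq : ∀ x, q (q x) = q x)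
    (hp' : ∀ x, p' (p' x) = p' x) (hq' : ∀ x, q' (q' x) = q' x)
    (hpq : ∀ x, q (p x) = p x) (hpq' : ∀ x, q' (p' x) = p' x)
    (h1 : ∀ x, p (p' x) = p' x) (h2 : ∀ x, p' (p x) = p x)
    (h3 : ∀ x, q (q' x) = q' x) (h4 : ∀ x, q' (q x) = q x) :
    layer p q ≃ₗ[S] layer p' q' where
  -- The two layers are complements of the same submodule, the common range of `p` and `p'`.
  -- Subtracting `p' x` moves `x` within its coset into the kernel of `p'`.
  toFun x := ⟨x - p' x, by
    have h := (mem_layer hq).1 x.2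
    have h5 : q' x = x := by rw [← h.1, h4]
    rw [mem_layer hq']; simp [h5, hp', hpq']⟩
  map_add' x y := by
    ext; simp; abel
  map_smul' c x := by
    ext; simp [smul_sub]
  invFun x := ⟨x - p x, by
    have h := (mem_layer hq').1 x.2
    have h5 : q x = x := by rw [← h.1, h3]
    rw [mem_layer hq]; simp [h5, hp, hpq]⟩
  left_inv x := by
    have h := (mem_layer hq).1 x.2
    ext; simp [h.2, h1]
  right_inv x := by
    have h := (mem_layer hq').1 x.2
    ext; simp [h.2, h2]

/-- Transport of layers along an isomorphism. -/
def layerConj (e : M ≃ₗ[S] N) {p q : Module.End S M} {p' q' : Module.End S N}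
    (hp : ∀ x, e (p x) = p' (e x)) (hq : ∀ x, e (q x) = q' (e x)) :
    layer p q ≃ₗ[S] layer p' q' :=
  e.ofSubmodules _ _ <| by
    ext y
    constructor
    · rintro ⟨_, ⟨⟨x, rfl⟩, h⟩, rfl⟩
      exact ⟨⟨e x, (hq x).symm⟩, (hp _).symm.trans ((congrArg e h).trans e.map_zero)⟩
    · rintro ⟨⟨x, rfl⟩, h⟩
      refine ⟨q (e.symm x), ⟨⟨_, rfl⟩, ?_⟩, by simp [hq]⟩
      apply e.injective
      rw [hp, hq, e.apply_symm_apply, e.map_zero]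
      exact h

end Layers

/-! ### Coordinate projections of a direct sum -/

section Restrict

variable {S : Type*} [Ring S] {I : Type*} {M : I → Type*} [∀ i, AddCommGroup (M i)]
  [∀ i, Module S (M i)]

open Classical in
variable (S M) in
/-- The projection of a direct sum onto the summands with index in `U`. -/
noncomputable def restr (U : Set I) : Module.End S (⨁ i, M i) :=
  DFinsupp.filterLinearMap S M (· ∈ U)

open Classical in
theorem restr_apply (U : Set I) (x : ⨁ i, M i) (i : I) :
    restr S M U x i = if i ∈ U then x i else 0 :=
  DFinsupp.filter_apply (· ∈ U) i x

theorem restr_restr {U V : Set I} (h : U ⊆ V) (x : ⨁ i, M i) :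
    restr S M V (restr S M U x) = restr S M U x := by
  classical
  refine DFinsupp.ext fun i => ?_
  simp only [restr_apply]
  grind

theorem restr_eq_self {U : Set I} {x : ⨁ i, M i} (h : ∀ i, x i ≠ 0 → i ∈ U) :
    restr S M U x = x := by
  classical
  refine DFinsupp.ext fun i => ?_
  simp only [restr_apply]
  grind

/-- Extension by zero. -/
theorem exists_extend_zero (U : Set I) (y : ⨁ i : U, M i) :
    ∃ x : ⨁ i, M i, (∀ i : U, x i = y i) ∧ ∀ i, i ∉ U → x i = 0 := by
  classical
  induction y using DirectSum.induction_on with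
  | zero => exact ⟨0, fun _ => rfl, fun _ _ => rfl⟩
  | of j m =>
    refine ⟨DirectSum.of M j m, fun i => ?_, fun i hi => ?_⟩
    · by_cases h : j = i
      · subst h
        rw [DirectSum.of_eq_same, DirectSum.of_eq_same]
      · rw [DirectSum.of_eq_of_ne _ _ _ (Ne.symm h), DirectSum.of_eq_of_ne]
        exact fun h' => h (Subtype.ext h'.symm)
    · refine DirectSum.of_eq_of_ne _ _ _ ?_
      rintro rfl
      exact hi j.2
  | add y z hy hz =>
    obtain ⟨a, ha, ha'⟩ := hy
    obtain ⟨b, hb, hb'⟩ := hz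
    refine ⟨a + b, fun i => ?_, fun i hi => ?_⟩
    · rw [DirectSum.add_apply, DirectSum.add_apply, ha, hb]
    · rw [DirectSum.add_apply, ha' i hi, hb' i hi, add_zero]

open Classical in
/-- The layers of the coordinate projections. -/
noncomputable def layerRestr (U V : Set I) :
    layer (restr S M U) (restr S M V) ≃ₗ[S] ⨁ i : (V \ U : Set I), M i :=
  LinearEquiv.ofBijective
    (DFinsupp.subtypeDomainLinearMap S M (· ∈ V \ U) ∘ₗ
      (layer (restr S M U) (restr S M V)).subtype) <| by
    have hm : ∀ {x : ⨁ i, M i}, x ∈ layer (restr S M U) (restr S M V) ↔ _ :=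
      mem_layer (restr_restr le_rfl)
    constructor
    · refine (injective_iff_map_eq_zero _).2 fun x hx => ?_
      obtain ⟨h1, h2⟩ := hm.1 x.2
      refine Subtype.ext (DFinsupp.ext fun i => ?_)
      by_cases hi : i ∈ V \ U
      · exact DFunLike.congr_fun hx (⟨i, hi⟩ : (V \ U : Set I))
      · by_cases hV : i ∈ V
        · have hU : i ∈ U := by simpa [hV] using hi
          have := DFunLike.congr_fun h2 i
          rwa [restr_apply, if_pos hU] at this
        · have := DFunLike.congr_fun h1 i
          rw [restr_apply, if_neg hV] at this
          exact this.symm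
    · intro y
      obtain ⟨x, hx, hx'⟩ := exists_extend_zero (V \ U) y
      refine ⟨⟨x, hm.2 ⟨restr_eq_self fun i hi => ?_, DFinsupp.ext fun i => ?_⟩⟩,
        DFinsupp.ext fun i => hx i⟩
      · by_contra hV
        exact hi (hx' i fun h => hV h.1)
      · rw [restr_apply]
        split_ifs with hU
        · exact hx' i fun h => h.2 hU
        · rfl

end Restrict

/-! ### Block decompositions and Kaplansky's theorem -/

section

variable {S : Type u} [Ring S]

theorem comp_restr_ext {I : Type*} {P : I → Type*} [∀ i, AddCommGroup (P i)]
    [∀ i, Module S (P i)] {M : Type*} [AddCommGroup M] [Module S M] (s : ∀ i, Set (P i))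
    (hs : ∀ i, Submodule.span S (s i) = ⊤) [DecidableEq I] (U : Set I) (f g : (⨁ i, P i) →ₗ[S] M)
    (h : ∀ i ∈ U, ∀ m ∈ s i, f (DirectSum.lof S I P i m) = g (DirectSum.lof S I P i m))
    (x : ⨁ i, P i) : f (restr S P U x) = g (restr S P U x) := by
  have key : f ∘ₗ restr S P U = g ∘ₗ restr S P U := by
    refine DirectSum.linearMap_ext S fun i => ?_
    refine LinearMap.ext_on (hs i) fun m hm => ?_
    simp only [LinearMap.comp_apply]
    by_cases hi : i ∈ U
    · have : restr S P U (DirectSum.lof S I P i m) = DirectSum.lof S I P i m := by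
        refine restr_eq_self fun j hj => ?_
        by_cases hij : j = i
        · rwa [hij]
        · exact (hj (DirectSum.of_eq_of_ne _ _ _ hij)).elim
      rw [this]
      exact h i hi m hm
    · have : restr S P U (DirectSum.lof S I P i m) = 0 := by
        classical
        refine DFinsupp.ext fun j => ?_
        rw [restr_apply]
        split_ifs with hj
        · refine DirectSum.of_eq_of_ne _ _ _ ?_
          rintro rfl
          exact hi hj
        · rfl
      rw [this, map_zero, map_zero]
  exact LinearMap.congr_fun key x

/-- The set of indices of the coordinates that occur in the images of generators of the `i`-th
summand. -/
def coordSupport {I J : Type u} {P : I → Type u} {Q : J → Type u} [∀ i, AddCommGroup (P i)]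
    [∀ i, Module S (P i)] [∀ i, AddCommGroup (Q i)] [∀ i, Module S (Q i)] [DecidableEq I]
    (s : ∀ i, Set (P i)) (f : (⨁ i, P i) →ₗ[S] ⨁ j, Q j) (i : I) : Set J :=
  ⋃ m : s i, {j | f (DirectSum.lof S I P i m) j ≠ 0}

section

variable {I J : Type u} {P : I → Type u} {Q : J → Type u} [∀ i, AddCommGroup (P i)]
  [∀ i, Module S (P i)] [∀ i, AddCommGroup (Q i)] [∀ i, Module S (Q i)] [DecidableEq I]

/-- Each of the fewer than `θ` generators has an image with finitely many nonzero coordinates, and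
`θ` is regular. -/
theorem mk_coordSupport_lt {θ : Cardinal.{u}} (hθ : θ.IsRegular) (s : ∀ i, Set (P i))
    (f : (⨁ i, P i) →ₗ[S] ⨁ j, Q j) (i : I) (hs : #(s i) < θ) :
    #(coordSupport (S := S) s f i : Set J) < θ := by
  classical
  refine (Cardinal.card_iUnion_lt_iff_forall_of_isRegular hθ hs).2 fun m => ?_
  refine lt_of_lt_of_le (Cardinal.lt_aleph0_iff_set_finite.2 ?_) hθ.aleph0_le
  exact DFinsupp.finite_support (f (DirectSum.lof S I P i m))

/-- This turns a combinatorial condition on index sets into the module statement that `f` carries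
the partial sum over `U` into the partial sum over `W`; by linearity the generators decide. -/
theorem restr_map_restr (s : ∀ i, Set (P i)) (hs : ∀ i, Submodule.span S (s i) = ⊤)
    (f : (⨁ i, P i) →ₗ[S] ⨁ j, Q j) {U : Set I} {W : Set J}
    (h : ∀ i ∈ U, coordSupport (S := S) s f i ⊆ W) (x : ⨁ i, P i) :
    restr S Q W (f (restr S P U x)) = f (restr S P U x) := by
  refine comp_restr_ext s hs U (restr S Q W ∘ₗ f) f (fun i hi m hm => ?_) x
  exact restr_eq_self (S := S) fun j hj => h i hi (Set.mem_iUnion.2 ⟨⟨m, hm⟩, hj⟩)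

end

/-- Two direct sum decompositions of a module into modules generated by fewer than `θ` elements,
with `θ` regular and uncountable, can be cut into blocks of fewer than `θ` summands such that
corresponding blocks are isomorphic. -/
theorem exists_block_decomposition {I J : Type u} {P : I → Type u} {Q : J → Type u}
    [∀ i, AddCommGroup (P i)] [∀ i, Module S (P i)] [∀ j, AddCommGroup (Q j)]
    [∀ j, Module S (Q j)] {θ : Cardinal.{u}} (hθ : θ.IsRegular) (h1 : ℵ₀ < θ)
    (hP : ∀ i, ∃ s : Set (P i), #s < θ ∧ Submodule.span S s = ⊤)
    (hQ : ∀ j, ∃ s : Set (Q j), #s < θ ∧ Submodule.span S s = ⊤)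
    (e : (⨁ i, P i) ≃ₗ[S] ⨁ j, Q j) :
    ∃ (a : I → I ⊕ J) (b : J → I ⊕ J), (∀ t, #{i // a i = t} < θ) ∧ (∀ t, #{j // b j = t} < θ) ∧
      ∀ t, Nonempty ((⨁ i : {i // a i = t}, P i) ≃ₗ[S] ⨁ j : {j // b j = t}, Q j) := by
  classical
  choose s hs hs' using hP
  choose r hr hr' using hQ
  -- An index on one side is sent to the indices on the other side that its generators reach under
  -- `e` or its inverse.
  let f : I ⊕ J → Set (I ⊕ J) := Sum.elim
    (fun i => Sum.inr '' coordSupport s e.toLinearMap i)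
    (fun j => Sum.inl '' coordSupport r e.symm.toLinearMap j)
  have hf : ∀ x, #(f x) < θ := by
    rintro (i | j)
    · exact Cardinal.mk_image_le.trans_lt (mk_coordSupport_lt hθ s _ i (hs i))
    · exact Cardinal.mk_image_le.trans_lt (mk_coordSupport_lt hθ r _ j (hr j))
  obtain ⟨_, _⟩ := exists_wellFoundedLT (I ⊕ J)
  obtain ⟨F⟩ := ClosedFiltration.nonempty hθ h1 f hf
  obtain ⟨c, hc⟩ := F.exists_step
  -- Both inclusions together say that `e` identifies the partial sums over the two halves of a
  -- closed set `W`.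
  have key : ∀ W : Set (I ⊕ J), (∀ x ∈ W, f x ⊆ W) →
      (∀ x, restr S Q (Sum.inr ⁻¹' W) (e (restr S P (Sum.inl ⁻¹' W) x)) =
        e (restr S P (Sum.inl ⁻¹' W) x)) ∧
      (∀ x, restr S P (Sum.inl ⁻¹' W) (e.symm (restr S Q (Sum.inr ⁻¹' W) x)) =
        e.symm (restr S Q (Sum.inr ⁻¹' W) x)) := by
    refine fun W hW => ⟨restr_map_restr s hs' e.toLinearMap fun i hi j hj => ?_,
      restr_map_restr r hr' e.symm.toLinearMap fun j hj i hi => ?_⟩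
    · exact hW _ hi ⟨j, hj, rfl⟩
    · exact hW _ hj ⟨i, hi, rfl⟩
  have hcard : ∀ {A : Type u} (g : A ↪ I ⊕ J) t, #{i // c (g i) = t} < θ := by
    intro A g t
    refine lt_of_le_of_lt (Cardinal.mk_le_of_injective
      (f := fun i : {i // c (g i) = t} => (⟨g i, (hc _ _).1 i.2⟩ : (F.V t \ F.U t : Set _)))
      fun i j h => ?_) (F.card_lt t)
    exact Subtype.ext (g.injective (congrArg Subtype.val h))
  refine ⟨fun i => c (Sum.inl i), fun j => c (Sum.inr j), hcard Function.Embedding.inl,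
    hcard Function.Embedding.inr, fun t => ⟨?_⟩⟩
  obtain ⟨hU1, hU2⟩ := key _ (F.closed_U t)
  obtain ⟨hV1, hV2⟩ := key _ (F.closed_V t)
  have hUVl : Sum.inl ⁻¹' F.U t ⊆ (Sum.inl ⁻¹' F.V t : Set I) :=
    Set.preimage_mono (F.U_subset_V t)
  have hUVr : Sum.inr ⁻¹' F.U t ⊆ (Sum.inr ⁻¹' F.V t : Set J) :=
    Set.preimage_mono (F.U_subset_V t)
  let p := restr S P (Sum.inl ⁻¹' F.U t)
  let q := restr S P (Sum.inl ⁻¹' F.V t)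
  -- Projections of the second sum are transported to the first, where on closed sets they have the
  -- same ranges as the projections there; `layerCongr` then applies.
  let conj : Set J → Module.End S (⨁ i, P i) := fun W =>
    e.symm.toLinearMap ∘ₗ restr S Q W ∘ₗ e.toLinearMap
  have conj_apply : ∀ W x, conj W x = e.symm (restr S Q W (e x)) := fun _ _ => rfl
  have e1 := layerRestr (S := S) (M := P) (Sum.inl ⁻¹' F.U t) (Sum.inl ⁻¹' F.V t)
  have e2 := layerRestr (S := S) (M := Q) (Sum.inr ⁻¹' F.U t) (Sum.inr ⁻¹' F.V t)
  have e3 : layer p q ≃ₗ[S] layer (conj (Sum.inr ⁻¹' F.U t)) (conj (Sum.inr ⁻¹' F.V t)) := by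
    refine layerCongr (restr_restr le_rfl) (restr_restr le_rfl) (fun x => ?_) (fun x => ?_)
      (restr_restr hUVl) (fun x => ?_) (fun x => ?_) (fun x => ?_) (fun x => ?_) (fun x => ?_)
    · simp [conj_apply, restr_restr le_rfl]
    · simp [conj_apply, restr_restr le_rfl]
    · simp [conj_apply, restr_restr hUVr]
    · exact hU2 (e x)
    · rw [conj_apply, hU1, e.symm_apply_apply]
    · exact hV2 (e x)
    · rw [conj_apply, hV1, e.symm_apply_apply]
  have e4 : layer (conj (Sum.inr ⁻¹' F.U t)) (conj (Sum.inr ⁻¹' F.V t)) ≃ₗ[S]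
      layer (restr S Q (Sum.inr ⁻¹' F.U t)) (restr S Q (Sum.inr ⁻¹' F.V t)) :=
    layerConj e (fun x => by simp [conj_apply]) (fun x => by simp [conj_apply])
  have e5 : (⨁ i : {i // c (Sum.inl i) = t}, P i) ≃ₗ[S]
      ⨁ i : (Sum.inl ⁻¹' F.V t \ Sum.inl ⁻¹' F.U t : Set I), P i :=
    DirectSum.lequivCongrLeft S (M := fun i : {i // c (Sum.inl i) = t} => P i)
      (Equiv.subtypeEquivRight fun i => hc _ _)
  have e6 : (⨁ j : {j // c (Sum.inr j) = t}, Q j) ≃ₗ[S]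
      ⨁ j : (Sum.inr ⁻¹' F.V t \ Sum.inr ⁻¹' F.U t : Set J), Q j :=
    DirectSum.lequivCongrLeft S (M := fun j : {j // c (Sum.inr j) = t} => Q j)
      (Equiv.subtypeEquivRight fun j => hc _ _)
  exact ((((e5.trans e1.symm).trans e3).trans e4).trans e2).trans e6.symm

/-- A module filtered along a well-order by ranges of idempotents is the direct sum of the layers of
the filtration. -/
theorem nonempty_equiv_directSum_layer {X M : Type*} [LinearOrder X] [WellFoundedLT X]
    [AddCommGroup M] [Module S M] (p q : X → Module.End S M)
    (hp : ∀ t x, p t (p t x) = p t x) (hq : ∀ t x, q t (q t x) = q t x)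
    (hpq : ∀ t x, q t (p t x) = p t x) (hqp : ∀ s t, s < t → ∀ x, p t (q s x) = q s x)
    (hlim : ∀ t x, p t x ≠ 0 → ∃ s < t, q s (p t x) = p t x)
    (htop : ∀ x, x ≠ 0 → ∃ t, q t x = x) :
    Nonempty (M ≃ₗ[S] ⨁ t, layer (p t) (q t)) := by
  suffices DirectSum.IsInternal fun t => layer (p t) (q t) from
    ⟨(LinearEquiv.ofBijective (DirectSum.coeLinearMap _) this).symm⟩
  apply DirectSum.isInternal_submodule_of_iSupIndep_of_iSup_eq_top
  · rw [iSupIndep_iff_finsetSum_eq_zero_imp_eq_zero]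
    -- In a vanishing sum, let `t` be the largest index with `v t ≠ 0`. Then `p t` kills `v t` and
    -- fixes all other terms, so these sum to zero by themselves and `v t = 0`.
    intro s v hv hsum
    by_contra! hne
    obtain ⟨t₀, ht₀, hne₀⟩ := hne
    classical
    obtain ⟨t, ht, hmax⟩ := (s.filter fun t => v t ≠ 0).exists_max_image id
      ⟨t₀, Finset.mem_filter.2 ⟨ht₀, hne₀⟩⟩
    rw [Finset.mem_filter] at ht
    apply ht.2
    have h1 := (mem_layer (hq t)).1 (hv t ht.1)
    have h2 := congrArg (p t) hsum
    rw [map_sum, map_zero, ← Finset.add_sum_erase _ _ ht.1, h1.2, zero_add] at h2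
    rw [← Finset.add_sum_erase _ _ ht.1] at hsum
    have h3 : ∑ i ∈ s.erase t, p t (v i) = ∑ i ∈ s.erase t, v i := by
      refine Finset.sum_congr rfl fun i hi => ?_
      rw [Finset.mem_erase] at hi
      by_cases h0 : v i = 0
      · rw [h0, map_zero]
      · have hlt : i < t := lt_of_le_of_ne (hmax i (Finset.mem_filter.2 ⟨hi.2, h0⟩)) hi.1
        rw [← ((mem_layer (hq i)).1 (hv i hi.2)).1, hqp i t hlt]
    rwa [← h3, h2, add_zero] at hsum
  · rw [eq_top_iff]
    -- Transfinite induction on `t`: `x - p t x` lies in the layer at `t`, and `p t x`, unless zero,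
    -- lies in the range of an earlier `q s`.
    have key : ∀ t x, q t x = x → x ∈ ⨆ t, layer (p t) (q t) := by
      intro t
      induction t using WellFoundedLT.induction with
      | ind t ih =>
        intro x hx
        have h1 : x - p t x ∈ ⨆ t, layer (p t) (q t) :=
          Submodule.mem_iSup_of_mem t ((mem_layer (hq t)).2 (by simp [hx, hpq, hp]))
        have h2 : p t x ∈ ⨆ t, layer (p t) (q t) := by
          by_cases h0 : p t x = 0
          · rw [h0]
            exact Submodule.zero_mem _
          · obtain ⟨s, hs, h⟩ := hlim t x h0
            exact ih s hs _ h
        simpa using Submodule.add_mem _ h1 h2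
    intro x _
    by_cases h0 : x = 0
    · rw [h0]
      exact Submodule.zero_mem _
    · obtain ⟨t, ht⟩ := htop x h0
      exact key t x ht

theorem exists_span_eq_top_of_eq_span {P : Type u} [AddCommGroup P] [Module S P]
    {N : Submodule S P} {G : Set P} (h : N = Submodule.span S G) :
    ∃ s : Set N, #s ≤ #G ∧ Submodule.span S s = ⊤ := by
  subst h
  exact ⟨_, Cardinal.mk_preimage_of_injective _ _ Subtype.val_injective,
    Submodule.span_span_coe_preimage⟩

/-- **Kaplansky's theorem**: a projective module is a direct sum of countably generated projective
modules. The index set of the sum is any given generating set of the module. -/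
theorem exists_directSum_countably_generated {P : Type u} [AddCommGroup P] [Module S P]
    [Module.Projective S P] (I : Set P) (hI : Submodule.span S I = ⊤) :
    ∃ Q : I → Submodule S P, (∀ i, Module.Projective S (Q i)) ∧
      (∀ i, ∃ s : Set (Q i), #s ≤ ℵ₀ ∧ Submodule.span S s = ⊤) ∧
      Nonempty (P ≃ₗ[S] ⨁ i, Q i) := by
  classical
  obtain ⟨_, _⟩ := exists_wellFoundedLT I
  let f : (⨁ _ : I, S) →ₗ[S] P := DirectSum.toModule S I P fun i => LinearMap.toSpanSingleton S P i
  have hf : Function.Surjective f := by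
    rw [← LinearMap.range_eq_top, eq_top_iff, ← hI, Submodule.span_le]
    intro i hi
    exact ⟨DirectSum.lof S I (fun _ => S) ⟨i, hi⟩ 1, by simp [f]⟩
  obtain ⟨g, hg⟩ := Module.projective_lifting_property f LinearMap.id hf
  replace hg : ∀ x, f (g x) = x := LinearMap.congr_fun hg
  let s : I → Set S := fun _ => {1}
  have hs : ∀ i, Submodule.span S (s i) = ⊤ := fun i => Ideal.span_singleton_one
  have hreg : (Order.succ ℵ₀ : Cardinal.{u}).IsRegular := Cardinal.isRegular_succ le_rfl
  obtain ⟨F⟩ := ClosedFiltration.nonempty hreg (Order.lt_succ ℵ₀) (coordSupport s (g ∘ₗ f))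
    fun i => mk_coordSupport_lt hreg s _ i (by
      rw [Cardinal.mk_singleton]; exact one_lt_aleph0.trans (Order.lt_succ _))
  let ρ : Set I → Module.End S (⨁ _ : I, S) := fun W => restr S (fun _ => S) W
  -- For `W` closed under the supports of `g ∘ f`, the map `g ∘ f` preserves the free module on `W`.
  -- This makes `E W` an idempotent with range the image under `f` of that free module.
  let E : Set I → Module.End S P := fun W => f ∘ₗ ρ W ∘ₗ g
  have E_apply : ∀ W x, E W x = f (ρ W (g x)) := fun _ _ => rfl
  have hcl : ∀ W : Set I, (∀ i ∈ W, coordSupport s (g ∘ₗ f) i ⊆ W) → ∀ x,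
      ρ W (g (f (ρ W x))) = g (f (ρ W x)) := fun W hW => restr_map_restr s hs (g ∘ₗ f) hW
  have hEf : ∀ W : Set I, (∀ i ∈ W, coordSupport s (g ∘ₗ f) i ⊆ W) → ∀ x,
      E W (f (ρ W x)) = f (ρ W x) := by
    intro W hW x
    rw [E_apply, hcl W hW, hg]
  have hEE : ∀ W W' : Set I, (∀ i ∈ W, coordSupport s (g ∘ₗ f) i ⊆ W) →
      (∀ i ∈ W', coordSupport s (g ∘ₗ f) i ⊆ W') → W ⊆ W' → ∀ x, E W' (E W x) = E W x := by
    intro W W' _ hW' h x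
    rw [E_apply W, ← restr_restr h (g x)]
    exact hEf W' hW' _
  have hsupp : ∀ (W : Set I) (x : P), (∀ i ∈ DFinsupp.support (g x), i ∈ W) → E W x = x := by
    intro W x h
    have : ρ W (g x) = g x := restr_eq_self fun i hi => h i (DFinsupp.mem_support_iff.2 hi)
    rw [E_apply, this, hg]
  have hne : ∀ x, x ≠ 0 → (DFinsupp.support (g x)).Nonempty := by
    intro x hx
    refine Finset.nonempty_iff_ne_empty.2 fun h => hx ?_
    rw [← hg x, DFinsupp.support_eq_empty.1 h]
    exact map_zero f
  have hUU := fun t => hEE _ _ (F.closed_U t) (F.closed_U t) le_rfl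
  have hVV := fun t => hEE _ _ (F.closed_V t) (F.closed_V t) le_rfl
  have hUV := fun t => hEE _ _ (F.closed_U t) (F.closed_V t) (F.U_subset_V t)
  refine ⟨fun t => layer (E (F.U t)) (E (F.V t)),
    fun t => projective_layer (hUU t) (hVV t) (hUV t), fun t => ?_,
    nonempty_equiv_directSum_layer (fun t => E (F.U t)) (fun t => E (F.V t)) hUU hVV hUV
      (fun r t hrt => hEE _ _ (F.closed_V r) (F.closed_U t) (F.V_subset_U r t hrt))
      (fun t x h0 => ?_) (fun x h0 => ?_)⟩
  · let h : (⨁ _ : I, S) →ₗ[S] P := f - E (F.U t) ∘ₗ f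
    have h_apply : ∀ y, h y = f y - E (F.U t) (f y) := fun _ => rfl
    -- Since `h` kills the image of the free module on `U t`, the layer is generated by the images
    -- of the basis vectors in `V t \ U t`, of which there are countably many.
    let G : Set P := (fun i : I => h (DirectSum.lof S I (fun _ => S) i 1)) '' (F.V t \ F.U t)
    have hG : layer (E (F.U t)) (E (F.V t)) = Submodule.span S G := by
      apply le_antisymm
      · intro x hx
        obtain ⟨h1, h2⟩ := (mem_layer (hVV t)).1 hx
        have hU0 : h (ρ (F.U t) (g x)) = 0 := by
          rw [h_apply, hEf _ (F.closed_U t), sub_self]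
        have hxV : h (ρ (F.V t) (g x)) = x := by
          have : f (ρ (F.V t) (g x)) = x := h1
          rw [h_apply, this, h2, sub_zero]
        have hsplit : ρ (F.V t) (g x) =
            ρ (F.U t) (g x) + ρ (F.V t \ F.U t) (g x) := by
          have hsub := F.U_subset_V t
          refine DFinsupp.ext fun i => ?_
          rw [DFinsupp.add_apply, restr_apply, restr_apply, restr_apply]
          by_cases hi : i ∈ F.U t
          · simp [hi, hsub hi]
          · simp [hi]
        rw [hsplit, map_add, hU0, zero_add] at hxV
        rw [← hxV, ← DirectSum.sum_support_of (ρ (F.V t \ F.U t) (g x)), map_sum]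
        refine Submodule.sum_mem _ fun i hi => ?_
        have hi' : i ∈ F.V t \ F.U t := by
          by_contra hn
          refine DFinsupp.mem_support_iff.1 hi ?_
          rw [restr_apply, if_neg hn]
        have : DirectSum.of (fun _ : I => S) i (ρ (F.V t \ F.U t) (g x) i) =
            (ρ (F.V t \ F.U t) (g x) i) • DirectSum.lof S I (fun _ => S) i 1 := by
          rw [← map_smul, smul_eq_mul, mul_one]
          rfl
        rw [this, map_smul]
        exact Submodule.smul_mem _ _ (Submodule.subset_span ⟨i, hi', rfl⟩)
      · rw [Submodule.span_le]
        rintro _ ⟨i, hi, rfl⟩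
        have hρ : ρ (F.V t) (DirectSum.lof S I (fun _ => S) i 1) =
            DirectSum.lof S I (fun _ => S) i 1 := by
          refine restr_eq_self fun j hj => ?_
          by_cases hij : j = i
          · exact hij ▸ hi.1
          · exact (hj (DirectSum.of_eq_of_ne _ _ _ hij)).elim
        have h1 : E (F.V t) (f (DirectSum.lof S I (fun _ => S) i 1)) =
            f (DirectSum.lof S I (fun _ => S) i 1) := by
          rw [← hρ]
          exact hEf _ (F.closed_V t) _
        refine (mem_layer (hVV t)).2 ⟨?_, ?_⟩
        · simp only [h_apply, map_sub, hUV, h1]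
        · simp only [h_apply, map_sub, hUU, sub_self]
    obtain ⟨v, hv, hv'⟩ := exists_span_eq_top_of_eq_span hG
    exact ⟨v, hv.trans (Cardinal.mk_image_le.trans (Order.le_of_lt_succ (F.card_lt t))), hv'⟩
  -- The finite support of `g (E (U t) x)` lies in `U t`, hence in an earlier `V r`, whose
  -- idempotent then fixes the element.
  · obtain ⟨r, hr, hr'⟩ := F.exists_finset_subset_V t _ (hne _ h0) fun i hi => by
      by_contra hn
      refine DFinsupp.mem_support_iff.1 hi ?_
      have : ρ (F.U t) (g (E (F.U t) x)) = g (E (F.U t) x) := hcl _ (F.closed_U t) _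
      rw [← this, restr_apply, if_neg hn]
    exact ⟨r, hr, hsupp _ _ hr'⟩
  · obtain ⟨t, ht, hmax⟩ := (DFinsupp.support (g x)).exists_max_image id (hne x h0)
    exact ⟨t, hsupp _ _ fun i hi => F.V_mono (hmax i hi) (F.mem_V i)⟩

end

/-! ### The zigzag for countable sums of finitely generated modules -/

section

variable {S : Type u} [Ring S]

theorem finite_coordSupport {I J : Type u} {P : I → Type u} {Q : J → Type u}
    [∀ i, AddCommGroup (P i)] [∀ i, Module S (P i)] [∀ i, AddCommGroup (Q i)]
    [∀ i, Module S (Q i)] [DecidableEq I] (s : ∀ i, Set (P i))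
    (f : (⨁ i, P i) →ₗ[S] ⨁ j, Q j) (i : I) (hs : (s i).Finite) :
    (coordSupport (S := S) s f i : Set J).Finite := by
  classical
  have := hs.to_subtype
  exact Set.finite_iUnion fun m => DFinsupp.finite_support (f (DirectSum.lof S I P i m))

/-- Interleaved exhaustions of two countable sets by finite sets. -/
theorem exists_interleaved_exhaustion {I J : Type*} [Countable I] [Countable J]
    (f : I → Set J) (g : J → Set I) (hf : ∀ i, (f i).Finite) (hg : ∀ j, (g j).Finite) :
    ∃ (F : ℕ → Set I) (G : ℕ → Set J), (∀ n, (F n).Finite) ∧ (∀ n, (G n).Finite) ∧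
      F 0 = ∅ ∧ G 0 = ∅ ∧ Monotone F ∧ Monotone G ∧ (∀ i, ∃ n, i ∈ F n) ∧ (∀ j, ∃ n, j ∈ G n) ∧
      (∀ n, ∀ i ∈ F n, f i ⊆ G n) ∧ ∀ n, ∀ j ∈ G n, g j ⊆ F (n + 1) := by
  obtain ⟨a, ha⟩ := exists_injective_nat I
  obtain ⟨b, hb⟩ := exists_injective_nat J
  -- The preimage of `Set.Iic n` under the injective enumeration is finite and ensures exhaustion;
  -- the last union absorbs the indices reached from the other side. The new second set is formed
  -- from the already enlarged first one.
  let nF : ℕ → Set I → Set J → Set I := fun n A B => A ∪ a ⁻¹' Set.Iic n ∪ ⋃ j ∈ B, g j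
  let nG : ℕ → Set I → Set J → Set J := fun n A B => B ∪ b ⁻¹' Set.Iic n ∪ ⋃ i ∈ A, f i
  let X : ℕ → Set I × Set J := fun n =>
    Nat.rec (∅, ∅) (fun n x => (nF n x.1 x.2, nG n (nF n x.1 x.2) x.2)) n
  have hX1 : ∀ n, (X (n + 1)).1 = nF n (X n).1 (X n).2 := fun _ => rfl
  have hX2 : ∀ n, (X (n + 1)).2 = nG n (X (n + 1)).1 (X n).2 := fun _ => rfl
  have hfin : ∀ n, (X n).1.Finite ∧ (X n).2.Finite := by
    intro n
    induction n with
    | zero => exact ⟨Set.finite_empty, Set.finite_empty⟩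
    | succ n ih =>
      have h1 : (X (n + 1)).1.Finite := (ih.1.union ((Set.finite_Iic n).preimage ha.injOn)).union
        (ih.2.biUnion fun j _ => hg j)
      exact ⟨h1, (ih.2.union ((Set.finite_Iic n).preimage hb.injOn)).union
        (h1.biUnion fun i _ => hf i)⟩
  refine ⟨fun n => (X n).1, fun n => (X n).2, fun n => (hfin n).1, fun n => (hfin n).2, rfl, rfl,
    monotone_nat_of_le_succ fun n => ?_, monotone_nat_of_le_succ fun n => ?_,
    fun i => ⟨a i + 1, ?_⟩, fun j => ⟨b j + 1, ?_⟩, fun n => ?_, fun n j hj k hk => ?_⟩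
  · exact fun i hi => Or.inl (Or.inl hi)
  · exact fun i hi => Or.inl (Or.inl hi)
  · exact Or.inl (Or.inr (Nat.le_refl _))
  · exact Or.inl (Or.inr (Nat.le_refl _))
  · cases n with
    | zero => exact fun i hi => hi.elim
    | succ n => exact fun i hi k hk => Or.inr (Set.mem_biUnion hi hk)
  · exact Or.inr (Set.mem_biUnion hj hk)

theorem exists_step_of_exhaustion {I : Type*} {F : ℕ → Set I} (h0 : F 0 = ∅) (hF : Monotone F)
    (hcov : ∀ i, ∃ n, i ∈ F n) : ∃ a : I → ℕ, ∀ i n, a i = n ↔ i ∈ F (n + 1) \ F n := by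
  classical
  have h : ∀ i, ∃ n, i ∈ F (n + 1) := by
    intro i
    obtain ⟨n, hn⟩ := hcov i
    exact ⟨n, hF n.le_succ hn⟩
  refine ⟨fun i => Nat.find (h i), fun i n => ?_⟩
  rw [Nat.find_eq_iff]
  refine and_congr_right fun _ => ⟨fun hm hn => ?_, fun hn m hm hi => hn (hF hm hi)⟩
  cases n with
  | zero => rw [h0] at hn; exact hn
  | succ n => exact hm n n.lt_succ_self hn

/-- Two countable direct sum decompositions of a module into finitely generated modules have a
zigzag of common refinements. -/
theorem exists_zigzag {I J : Type u} [Countable I] [Countable J] {P : I → Type u} {Q : J → Type u}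
    [∀ i, AddCommGroup (P i)] [∀ i, Module S (P i)] [∀ j, AddCommGroup (Q j)]
    [∀ j, Module S (Q j)] [∀ i, Module.Finite S (P i)] [∀ j, Module.Finite S (Q j)]
    [∀ i, Module.Projective S (P i)] (e : (⨁ i, P i) ≃ₗ[S] ⨁ j, Q j) :
    ∃ (a : I → ℕ) (b : J → ℕ) (D : ℕ → Submodule S (⨁ i, P i)),
      (∀ n, {i | a i = n}.Finite) ∧ (∀ n, {j | b j = n}.Finite) ∧ D 0 = ⊥ ∧
      (∀ n, Module.Projective S (D n)) ∧
      (∀ n, Nonempty ((⨁ i : {i // a i = n}, P i) ≃ₗ[S] D (2 * n) × D (2 * n + 1))) ∧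
      ∀ n, Nonempty ((⨁ j : {j // b j = n}, Q j) ≃ₗ[S] D (2 * n + 1) × D (2 * n + 2)) := by
  classical
  choose s hs using fun i => (Module.Finite.fg_top : (⊤ : Submodule S (P i)).FG)
  choose r hr using fun j => (Module.Finite.fg_top : (⊤ : Submodule S (Q j)).FG)
  obtain ⟨F, G, hF, hG, hF0, hG0, hFm, hGm, hFc, hGc, hFG, hGF⟩ := exists_interleaved_exhaustion
    (coordSupport (S := S) (fun i => (s i : Set (P i))) e.toLinearMap)
    (coordSupport (S := S) (fun j => (r j : Set (Q j))) e.symm.toLinearMap)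
    (fun i => finite_coordSupport _ _ i (s i).finite_toSet)
    (fun j => finite_coordSupport _ _ j (r j).finite_toSet)
  obtain ⟨a, ha⟩ := exists_step_of_exhaustion hF0 hFm hFc
  obtain ⟨b, hb⟩ := exists_step_of_exhaustion hG0 hGm hGc
  let conj : Set J → Module.End S (⨁ i, P i) := fun W =>
    e.symm.toLinearMap ∘ₗ restr S Q W ∘ₗ e.toLinearMap
  have conj_apply : ∀ W x, conj W x = e.symm (restr S Q W (e x)) := fun _ _ => rfl
  -- Even terms project onto the partial sums over `F n`, odd terms onto the transported partial
  -- sums over `G n`. Their ranges form one increasing chain, whose layers are the modules `D n`.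
  let ε : ℕ → Module.End S (⨁ i, P i) := fun n =>
    if n % 2 = 0 then restr S P (F (n / 2)) else conj (G (n / 2))
  have hε0 : ∀ n, ε (2 * n) = restr S P (F n) := by
    intro n
    simp [ε]
  have hε1 : ∀ n, ε (2 * n + 1) = conj (G n) := by
    intro n
    have h1 : (2 * n + 1) % 2 = 1 := by omega
    have h2 : (2 * n + 1) / 2 = n := by omega
    simp [ε, h1, h2]
  have hε2 : ∀ n, ε (2 * n + 2) = restr S P (F (n + 1)) := fun n => hε0 (n + 1)
  have hid : ∀ n x, ε n (ε n x) = ε n x := by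
    intro n x
    obtain ⟨k, rfl | rfl⟩ := n.even_or_odd'
    · rw [hε0]
      exact restr_restr le_rfl x
    · rw [hε1, conj_apply, conj_apply, e.apply_symm_apply, restr_restr le_rfl]
  have hsucc : ∀ n x, ε (n + 1) (ε n x) = ε n x := by
    intro n x
    obtain ⟨k, rfl | rfl⟩ := n.even_or_odd'
    · rw [hε0, hε1, conj_apply]
      have := restr_map_restr (fun i => (s i : Set (P i))) hs e.toLinearMap (hFG k) x
      exact e.symm_apply_eq.2 this
    · rw [hε1, hε2]
      exact restr_map_restr (fun j => (r j : Set (Q j))) hr e.symm.toLinearMap (hGF k) (e x)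
  refine ⟨a, b, fun n => layer (ε n) (ε (n + 1)), fun n => (hF (n + 1)).subset fun i hi =>
    ((ha i n).1 hi).1, fun n => (hG (n + 1)).subset fun j hj => ((hb j n).1 hj).1, ?_,
    fun n => projective_layer (hid _) (hid _) (hsucc _), fun n => ⟨?_⟩, fun n => ⟨?_⟩⟩
  -- Since `G 0` is empty, `ε 1` is zero and so is the layer below it.
  · refine (Submodule.eq_bot_iff _).2 fun x hx => ?_
    rw [← ((mem_layer (hid _)).1 hx).1, show (0 : ℕ) + 1 = 2 * 0 + 1 from rfl, hε1, conj_apply, hG0]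
    refine e.symm_apply_eq.2 ?_
    rw [map_zero]
    refine DFinsupp.ext fun j => ?_
    rw [restr_apply, if_neg (Set.notMem_empty j)]
    rfl
  · refine LinearEquiv.trans (?_ : _ ≃ₗ[S] layer (ε (2 * n)) (ε (2 * n + 1 + 1)))
      (layerProdEquiv (hid _) (hid (2 * n + 1)) (hid _)
        (hsucc _) (hsucc _))
    rw [show 2 * n + 1 + 1 = 2 * n + 2 from rfl, hε0, hε2]
    exact (DirectSum.lequivCongrLeft S (M := fun i : {i // a i = n} => P i)
      (Equiv.subtypeEquivRight fun i => ha _ _)).trans (layerRestr (F n) (F (n + 1))).symm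
  · refine LinearEquiv.trans (?_ : _ ≃ₗ[S] layer (ε (2 * n + 1)) (ε (2 * n + 1 + 1 + 1)))
      (layerProdEquiv (hid _) (hid (2 * n + 1 + 1)) (hid _)
        (hsucc _) (hsucc _))
    rw [show 2 * n + 1 + 1 + 1 = 2 * (n + 1) + 1 from rfl, hε1, hε1]
    have e1 : layer (conj (G n)) (conj (G (n + 1))) ≃ₗ[S]
        layer (restr S Q (G n)) (restr S Q (G (n + 1))) :=
      layerConj e (fun x => by simp [conj_apply]) (fun x => by simp [conj_apply])
    exact ((DirectSum.lequivCongrLeft S (M := fun j : {j // b j = n} => Q j)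
      (Equiv.subtypeEquivRight fun j => hb _ _)).trans (layerRestr (G n) (G (n + 1))).symm).trans
        e1.symm

end

/-! ### Direct sums of isomorphism classes -/

namespace ModClass

variable {S : Type u} [Ring S]

theorem dsum_comp_embedding {I J : Type u} (x : J → ModClass S) (l : I ↪ J)
    (hl : ∀ j, x j ≠ zero S → j ∈ Set.range l) : dsum (fun i => x (l i)) = dsum x := by
  classical
  have h1 : dsum (fun i => x (l i)) = dsum fun j : Set.range l => x j := by
    rw [← dsum_reindex (Equiv.ofInjective l l.injective).symm]
    rfl
  rw [h1]
  refine (mk_eq_mk.2 ⟨LinearEquiv.ofBijective (DFinsupp.subtypeDomainLinearMap S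
    (fun j => ((x j).rep : Type u)) (· ∈ Set.range l)) ⟨?_, fun y => ?_⟩⟩).symm
  · refine (injective_iff_map_eq_zero _).2 fun z hz => DFinsupp.ext fun j => ?_
    by_cases hj : j ∈ Set.range l
    · exact DFunLike.congr_fun hz (⟨j, hj⟩ : Set.range l)
    · have : Subsingleton (x j).rep := by
        rw [← mk_eq_zero (S := S), mk_rep]
        exact not_not.1 (mt (hl j) hj)
      exact Subsingleton.elim _ _
  · obtain ⟨z, hz, -⟩ := exists_extend_zero (M := fun j => ((x j).rep : Type u)) (Set.range l) y
    exact ⟨z, DFinsupp.ext fun j => hz j⟩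

theorem dsum_extend {I J : Type u} (x : I → ModClass S) (l : I ↪ J) :
    dsum (Function.extend l x fun _ => zero S) = dsum x := by
  rw [← dsum_comp_embedding _ l]
  · simp only [l.injective.extend_apply]
  · intro j hj
    by_contra h
    exact hj (Function.extend_apply' _ _ _ h)

theorem dsum_option {I : Type u} (x : Option I → ModClass S) :
    dsum x = add (x none) (dsum fun i => x (some i)) := by
  conv_rhs => rw [← mk_rep (x none)]
  exact (mk_eq_mk.2 ⟨DirectSum.lequivProdDirectSum S (α := fun i => ((x i).rep : Type u))⟩).trans
    (add_mk _ _).symm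

theorem IsProjLT.isProjLE {θ κ : Cardinal.{u}} (hle : θ ≤ Order.succ κ) {c : ModClass S}
    (h : c.IsProjLT θ) : c.IsProjLE κ :=
  ⟨h.1, h.2.imp fun _ h => ⟨Order.le_of_lt_succ (h.1.trans_le hle), h.2⟩⟩

/-- In a direct sum decomposition of a module generated by at most `κ` elements at most `κ`
summands are nonzero. -/
theorem mk_ne_zero_le {κ : Cardinal.{u}} (hκ : ℵ₀ ≤ κ) {I : Type u} (x : I → ModClass S)
    {c : ModClass S} (hc : c.IsProjLE κ) (hx : c = dsum x) : #{i // x i ≠ zero S} ≤ κ := by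
  classical
  subst hx
  obtain ⟨-, s, hs, hs'⟩ := isProjLE_mk.1 hc
  -- If no generator has a nonzero coordinate at `i`, the projection onto that summand vanishes,
  -- although it is surjective.
  have hsub : {i | x i ≠ zero S} ⊆ ⋃ m : s, (↑(DFinsupp.support m.1) : Set I) := by
    intro i hi
    by_contra hn
    refine hi ?_
    rw [← mk_rep (x i), mk_eq_zero]
    have h0 : DirectSum.component S I (fun i => ((x i).rep : Type u)) i = 0 := by
      refine LinearMap.ext_on hs' fun m hm => ?_
      by_contra h
      exact hn (Set.mem_iUnion.2 ⟨⟨m, hm⟩, DFinsupp.mem_support_iff.2 h⟩)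
    refine subsingleton_of_forall_eq 0 fun y => ?_
    rw [← DirectSum.component.lof_self S (M := fun i => ((x i).rep : Type u)) i y, h0]
    rfl
  refine (Cardinal.mk_le_mk_of_subset hsub).trans ((Cardinal.mk_iUnion_le _).trans ?_)
  refine (mul_le_mul' hs (ciSup_le' fun m => ?_)).trans (Cardinal.mul_eq_self hκ).le
  exact ((Cardinal.lt_aleph0_of_finite _).le).trans hκ

end ModClass

theorem KMinusMonoid.mk_extend_ne_zero_lt {θ : Cardinal.{u}} {H : Type w} (A : KMinusMonoid θ H)
    {J : Type u} (y : J → H) (hJ : #J < θ) (e : J ↪ CardIdx θ) :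
    #{i // Function.extend e y (fun _ => A.zero) i ≠ A.zero} < θ := by
  have hsupp : ∀ i, Function.extend e y (fun _ => A.zero) i ≠ A.zero → i ∈ Set.range e := by
    intro i hi
    by_contra h
    exact hi (Function.extend_apply' _ _ _ h)
  refine lt_of_le_of_lt (Cardinal.mk_le_of_injective
    (f := fun i => (hsupp i.1 i.2).choose) ?_) hJ
  intro i i' h
  refine Subtype.ext ?_
  rw [← (hsupp i.1 i.2).choose_spec, ← (hsupp i'.1 i'.2).choose_spec]
  exact congrArg e h

theorem nonempty_sum_cardIdx_embedding {κ : Cardinal.{u}} (hκ : ℵ₀ ≤ κ) :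
    Nonempty (CardIdx κ ⊕ CardIdx κ ↪ CardIdx κ) := by
  apply KMonoid.exists_embedding
  simp [Cardinal.add_eq_self hκ]

/-! ### Universality over classes with fewer than θ generators, θ uncountable -/

section

variable {R : Type u} [Ring R] {κ : Cardinal.{u}} (hκ : ℵ₀ ≤ κ)

theorem vKappa_tot {J : Type u} (x : J → VKappa R κ) (hJ : Nonempty (J ↪ CardIdx κ)) :
    ((vKappa R κ hκ).tot x).1 = ModClass.dsum fun j => (x j).1 := by
  obtain ⟨e⟩ := hJ
  rw [(vKappa R κ hκ).tot_eq x e, ← ModClass.dsum_extend _ e]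
  change ModClass.dsum _ = _
  congr 1
  funext k
  by_cases hk : ∃ j, e j = k
  · obtain ⟨j, rfl⟩ := hk
    rw [e.injective.extend_apply, e.injective.extend_apply]
  · rw [Function.extend_apply' _ _ _ hk, Function.extend_apply' _ _ _ hk]
    rfl

theorem vKappa_sumOver {J : Type u} (x : J → VKappa R κ)
    (hx : #{j // x j ≠ (vKappa R κ hκ).zero} ≤ κ) :
    ((vKappa R κ hκ).sumOver x hx).1 = ModClass.dsum fun j => (x j).1 := by
  rw [(vKappa R κ hκ).sumOver_eq_tot_support x hx, vKappa_tot hκ _ (KMonoid.exists_embedding hx)]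
  refine ModClass.dsum_comp_embedding (fun j => (x j).1) (Function.Embedding.subtype _)
    fun j hj => ⟨⟨j, fun h => hj ?_⟩, rfl⟩
  rw [h]
  rfl

variable {θ : Cardinal.{u}} {hle : θ ≤ Order.succ κ} {H : Type w} {A : KMinusMonoid θ H}
  {ι : H → VKappa R κ}

/-- The hypothesis is a statement about direct sums only, so that `V^{θ⁻}(R)`, `V^{ℵ₀}(R)` and
`V(R)` are treated alike. -/
theorem isKMinusHom_vKappa (h0 : ι A.zero = (vKappa R κ hκ).zero)
    (hsum : ∀ x hx, (ι (A.sum x hx)).1 = ModClass.dsum fun i => (ι (x i)).1) :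
    IsKMinusHom A ((vKappa R κ hκ).toMinus θ A.isRegular hle) ι :=
  ⟨h0, fun x hx hx' => Subtype.ext <| (hsum x hx).trans
    (vKappa_sumOver hκ _ (Order.le_of_lt_succ (hx'.trans_le hle))).symm⟩

/-- Sums of fewer than `θ` elements are respected by `θ⁻`-homomorphisms. -/
theorem exists_map_eq_tot (h0 : ι A.zero = (vKappa R κ hκ).zero)
    (hsum : ∀ x hx, (ι (A.sum x hx)).1 = ModClass.dsum fun i => (ι (x i)).1)
    {K : Type w'} {C : KMonoid κ K} {φ : H → K}
    (hφ : IsKMinusHom A (C.toMinus θ A.isRegular hle) φ) {J : Type u} (hJ : #J < θ) (y : J → H) :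
    ∃ h, φ h = C.tot (fun j => φ (y j)) ∧ (ι h).1 = ModClass.dsum fun j => (ι (y j)).1 := by
  obtain ⟨e⟩ := KMonoid.exists_embedding hJ.le
  have hx := A.mk_extend_ne_zero_lt y hJ e
  refine ⟨_, hφ.map_sum_extend y hJ e hx, ?_⟩
  rw [hsum, ← ModClass.dsum_extend _ e]
  congr 1
  funext k
  by_cases hk : ∃ j, e j = k
  · obtain ⟨j, rfl⟩ := hk
    rw [e.injective.extend_apply, e.injective.extend_apply]
  · rw [Function.extend_apply' _ _ _ hk, Function.extend_apply' _ _ _ hk, h0]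
    rfl

/-- A class is a sum in `V^κ(R)` of elements in the image of `ι` if it is the class of a direct sum
of modules with classes in that image. -/
theorem exists_sum_eq_of_dsum (h0 : ι A.zero = (vKappa R κ hκ).zero) (c : VKappa R κ)
    {I : Type u} (y : I → H) (hc : c.1 = ModClass.dsum fun i => (ι (y i)).1) :
    ∃ z : CardIdx κ → H, (vKappa R κ hκ).sum (fun i => ι (z i)) = c := by
  obtain ⟨e⟩ := KMonoid.exists_embedding (ModClass.mk_ne_zero_le hκ _ c.2 hc)
  refine ⟨Function.extend e (fun i => y i.1) fun _ => A.zero, Subtype.ext ?_⟩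
  rw [hc, ← ModClass.dsum_comp_embedding (fun i => (ι (y i)).1)
    (Function.Embedding.subtype fun i => (ι (y i)).1 ≠ ModClass.zero _)
    fun i hi => ⟨⟨i, hi⟩, rfl⟩, ← ModClass.dsum_extend _ e]
  change ModClass.dsum _ = _
  congr 1
  funext k
  by_cases hk : ∃ j, e j = k
  · obtain ⟨j, rfl⟩ := hk
    beta_reduce
    rw [e.injective.extend_apply, e.injective.extend_apply]
    rfl
  · beta_reduce
    rw [Function.extend_apply' _ _ _ hk, Function.extend_apply' _ _ _ hk, h0]
    rfl

/-- Universality for the classes of projective modules generated by fewer than `θ` elements, where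
`θ` is uncountable. -/
theorem isUniversalExtension_vKappa {H : Type (u + 1)} {A : KMinusMonoid θ H}
    {ι : H → VKappa R κ} (hθ : ℵ₀ < θ) (h0 : ι A.zero = (vKappa R κ hκ).zero)
    (hsum : ∀ x hx, (ι (A.sum x hx)).1 = ModClass.dsum fun i => (ι (x i)).1)
    (hinj : Function.Injective ι) (hlt : ∀ h, (ι h).1.IsProjLT θ)
    (hrange : ∀ c : VKappa R κ, c.1.IsProjLT θ → ∃ h, ι h = c) :
    IsUniversalExtension.{u, u + 1, w} hle A (vKappa R κ hκ) ι := by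
  refine isUniversalExtension_of_sum (isKMinusHom_vKappa hκ h0 hsum) (fun c => ?_)
    fun K C φ hφ c c' hcc' => ?_
  · obtain ⟨hP, s, hs, hs'⟩ := c.2
    obtain ⟨Q, hQ, hQ', ⟨e⟩⟩ := exists_directSum_countably_generated s hs'
    have hQθ : ∀ i, (ModClass.mk (Q i) : ModClass Rᵐᵒᵖ).IsProjLT θ := fun i =>
      ModClass.isProjLT_mk.2 ⟨hQ i, (hQ' i).imp fun _ h => ⟨h.1.trans_lt hθ, h.2⟩⟩
    choose y hy using fun i => hrange ⟨_, (hQθ i).isProjLE hle⟩ (hQθ i)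
    refine exists_sum_eq_of_dsum hκ h0 c y ?_
    simp only [hy]
    exact (ModClass.mk_rep c.1).symm.trans
      ((ModClass.mk_eq_mk.2 ⟨e⟩).trans (ModClass.dsum_mk fun i => Q i).symm)
  · obtain ⟨e⟩ := ModClass.mk_eq_mk.1 (congrArg Subtype.val hcc')
    obtain ⟨a, b, ha, hb, hab⟩ := exists_block_decomposition A.isRegular hθ
      (fun i => (hlt (c i)).2) (fun j => (hlt (c' j)).2) e
    have hκκ := nonempty_sum_cardIdx_embedding hκ
    have hid : Nonempty (CardIdx κ ↪ CardIdx κ) := ⟨Function.Embedding.refl _⟩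
    rw [← C.tot_cardIdx, ← C.tot_cardIdx, C.tot_fiber hid hκκ a, C.tot_fiber hid hκκ b]
    congr 1
    funext t
    obtain ⟨h, hh, hh'⟩ := exists_map_eq_tot hκ h0 hsum hφ (ha t) fun i => c i
    obtain ⟨k, hk, hk'⟩ := exists_map_eq_tot hκ h0 hsum hφ (hb t) fun i => c' i
    -- Corresponding blocks are sums inside `H` with isomorphic underlying modules, so they are one
    -- element of `H` and have one image under `φ`.
    have : h = k := hinj (Subtype.ext (hh'.trans ((ModClass.mk_eq_mk.2 (hab t)).trans hk'.symm)))
    rw [← hh, ← hk, this]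

end

/-! ### Universality over V(R) -/

theorem KMonoid.tot_nat_pairs {κ : Cardinal.{u}} {H : Type w} (A : KMonoid κ H) (x : ℕ → H) :
    A.tot x = A.tot fun n => A.tot fun b : Option PUnit.{u + 1} =>
      b.elim (x (2 * n)) fun _ => x (2 * n + 1) := by
  let f : (Σ _ : ℕ, Option PUnit.{u + 1}) → ℕ := fun q => q.2.elim (2 * q.1) fun _ => 2 * q.1 + 1
  have hf : Function.Bijective f := by
    constructor
    · rintro ⟨n, _ | _⟩ ⟨m, _ | _⟩ h <;> simp only [f, Option.elim] at h
      · obtain rfl : n = m := by omega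
        rfl
      · omega
      · omega
      · obtain rfl : n = m := by omega
        rfl
    · intro n
      obtain ⟨k, rfl | rfl⟩ := n.even_or_odd'
      · exact ⟨⟨k, none⟩, rfl⟩
      · exact ⟨⟨k, some PUnit.unit⟩, rfl⟩
  rw [← A.tot_equiv x (A.nonempty_embedding_of_countable ℕ) (Equiv.ofBijective f hf),
    A.tot_sigma (A.nonempty_embedding_of_countable ℕ)
      fun _ => A.nonempty_embedding_of_countable _]
  congr 1
  funext n
  congr 1
  funext b
  cases b <;> rfl

section

variable {R : Type u} [Ring R] {κ : Cardinal.{u}} (hκ : ℵ₀ ≤ κ)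

theorem VFin.val_finsum_of_finite (I : Type u) [Finite I] :
    ∀ x : I → VFin R, (∑ᶠ i, x i).1 = ModClass.dsum fun i => (x i).1 := by
  induction I using Finite.induction_empty_option with
  | of_equiv e ih =>
    intro x
    rw [← finsum_comp_equiv e, ih, ← ModClass.dsum_reindex e]
    simp
  | h_empty =>
    intro x
    rw [finsum_of_isEmpty]
    exact (ModClass.mk_eq_zero.2 inferInstance).symm
  | h_option ih =>
    intro x
    rw [finsum_eq_sum_of_fintype, Fintype.sum_option, ModClass.dsum_option, ← ih,
      finsum_eq_sum_of_fintype]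
    rfl

theorem VFin.val_finsum {I : Type u} (x : I → VFin R) (hx : (Function.support x).Finite) :
    (∑ᶠ i, x i).1 = ModClass.dsum fun i => (x i).1 := by
  have := hx.to_subtype
  rw [← finsum_mem_support, ← finsum_set_coe_eq_finsum_mem, VFin.val_finsum_of_finite]
  refine ModClass.dsum_comp_embedding (fun i => (x i).1) (Function.Embedding.subtype _)
    fun i hi => ⟨⟨i, fun h => hi ?_⟩, rfl⟩
  rw [h]
  rfl

theorem VFin.incl_sum (x : CardIdx ℵ₀ → VFin R)
    (hx : #{i // x i ≠ (KMinusMonoid.ofAddCommMonoid (VFin R)).zero} < ℵ₀) :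
    (VFin.incl hκ ((KMinusMonoid.ofAddCommMonoid (VFin R)).sum x hx)).1 =
      ModClass.dsum fun i => (VFin.incl hκ (x i)).1 :=
  VFin.val_finsum x (Cardinal.lt_aleph0_iff_set_finite.1 hx)

variable {K : Type w} {C : KMonoid κ K} {φ : VFin R → K}

theorem VFin.exists_map_eq_tot (hφ : IsKMinusHom (KMinusMonoid.ofAddCommMonoid (VFin R))
      (C.toMinus ℵ₀ Cardinal.isRegular_aleph0 (hκ.trans (Order.le_succ κ))) φ)
    {J : Type u} [Finite J] (y : J → VFin R) :
    ∃ h, φ h = C.tot (fun j => φ (y j)) ∧ h.1 = ModClass.dsum fun j => (y j).1 :=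
  _root_.exists_map_eq_tot hκ (hle := hκ.trans (Order.le_succ κ)) (ι := VFin.incl hκ) rfl
    (VFin.incl_sum hκ) hφ (Cardinal.lt_aleph0_of_finite J) y

theorem VFin.map_add_eq_tot (hφ : IsKMinusHom (KMinusMonoid.ofAddCommMonoid (VFin R))
      (C.toMinus ℵ₀ Cardinal.isRegular_aleph0 (hκ.trans (Order.le_succ κ))) φ)
    (c d : VFin R) :
    φ (c + d) = C.tot fun b : Option PUnit.{u + 1} => b.elim (φ c) fun _ => φ d := by
  obtain ⟨h, hh, hh'⟩ := VFin.exists_map_eq_tot hκ hφ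
    (fun b : Option PUnit.{u + 1} => b.elim c fun _ => d)
  have : h = c + d := by
    rw [ModClass.dsum_option, ModClass.dsum_single _ PUnit.unit fun i hi => (hi rfl).elim] at hh'
    exact Subtype.ext hh'
  rw [← this, hh]
  congr 1
  funext b
  cases b <;> rfl

/-- Isomorphisms of countable direct sums of finitely generated projective modules are respected by
homomorphisms of monoids from `V(R)` to `κ`-monoids. -/
theorem VFin.tot_eq_tot_of_countable (hφ : IsKMinusHom (KMinusMonoid.ofAddCommMonoid (VFin R))
      (C.toMinus ℵ₀ Cardinal.isRegular_aleph0 (hκ.trans (Order.le_succ κ))) φ)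
    {I J : Type u} [Countable I] [Countable J] (x : I → VFin R) (y : J → VFin R)
    (hxy : (ModClass.dsum fun i => (x i).1) = ModClass.dsum fun j => (y j).1) :
    C.tot (fun i => φ (x i)) = C.tot fun j => φ (y j) := by
  obtain ⟨e⟩ := ModClass.mk_eq_mk.1 hxy
  have := fun i => (x i).2.1
  have := fun i => (x i).2.2
  have := fun j => (y j).2.2
  obtain ⟨a, b, D, ha, hb, hD0, hDP, hPD, hQD⟩ := exists_zigzag e
  -- Each `D n` is a direct factor of a block consisting of finitely many of the finitely generated
  -- modules.
  have hDfg : ∀ n, Module.Finite Rᵐᵒᵖ (D n) := by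
    intro n
    obtain ⟨k, hk⟩ := n.even_or_odd'
    have : Finite {i // a i = k} := (ha k).to_subtype
    obtain ⟨f⟩ := hPD k
    have := Module.Finite.equiv f
    obtain rfl | rfl := hk
    · exact Module.Finite.of_surjective (LinearMap.fst Rᵐᵒᵖ (D (2 * k)) (D (2 * k + 1)))
        LinearMap.fst_surjective
    · exact Module.Finite.of_surjective (LinearMap.snd Rᵐᵒᵖ (D (2 * k)) (D (2 * k + 1)))
        LinearMap.snd_surjective
  let d : ℕ → VFin R := fun n => ⟨ModClass.mk (D n), ModClass.isProjFG_mk.2 ⟨hDP n, hDfg n⟩⟩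
  have hd0 : φ (d 0) = C.zero := by
    have : d 0 = (KMinusMonoid.ofAddCommMonoid (VFin R)).zero := by
      refine Subtype.ext (ModClass.mk_eq_zero.2 ?_)
      rw [hD0]
      infer_instance
    rw [this]
    exact hφ.map_zero
  have hℕ := C.nonempty_embedding_of_countable ℕ
  have key : ∀ {L : Type u} [Countable L] (z : L → VFin R) (c : L → ℕ)
      (_ : ∀ n, {i | c i = n}.Finite) (d₁ d₂ : ℕ → ℕ)
      (_ : ∀ n, Nonempty ((⨁ i : {i // c i = n}, (z i).1.rep) ≃ₗ[Rᵐᵒᵖ] D (d₁ n) × D (d₂ n))),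
      C.tot (fun i => φ (z i)) = C.tot fun n => C.tot fun b : Option PUnit.{u + 1} =>
        b.elim (φ (d (d₁ n))) fun _ => φ (d (d₂ n)) := by
    intro L _ z c hc d₁ d₂ hz
    rw [C.tot_fiber (C.nonempty_embedding_of_countable L) hℕ c]
    congr 1
    funext n
    have : Finite {i // c i = n} := (hc n).to_subtype
    obtain ⟨h, hh, hh'⟩ := VFin.exists_map_eq_tot hκ hφ fun i : {i // c i = n} => z i
    rw [← VFin.map_add_eq_tot hκ hφ, ← hh]
    congr 1
    exact Subtype.ext (hh'.trans ((ModClass.mk_eq_mk.2 (hz n)).trans (ModClass.add_mk _ _).symm))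
  -- Removing the brackets leaves the sums of `φ (d n)` from `n = 0` and from `n = 1`, which agree
  -- because `φ (d 0)` is zero.
  rw [key x a ha _ _ hPD, key y b hb _ _ hQD, ← C.tot_nat_pairs fun n => φ (d n),
    ← C.tot_nat_pairs fun n => φ (d (n + 1))]
  refine (C.tot_comp_embedding (fun n => φ (d n)) hℕ ⟨_, Nat.succ_injective⟩ fun n hn => ?_).symm
  cases n with
  | zero => exact (hn hd0).elim
  | succ n => exact ⟨n, rfl⟩

/-- Universality of `V^κ(R)` over `V(R)`, when projective modules are direct sums of finitely
generated modules. -/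
theorem isUniversalExtension_vFin
    (hR : ∀ (P : Type u) [AddCommGroup P] [Module Rᵐᵒᵖ P], Module.Projective Rᵐᵒᵖ P →
      ∃ (I : Type u) (N : I → ModuleCat.{u} Rᵐᵒᵖ),
        (∀ i, Module.Finite Rᵐᵒᵖ (N i)) ∧ Nonempty (P ≃ₗ[Rᵐᵒᵖ] ⨁ i, N i)) :
    IsUniversalExtension.{u, u + 1, w} (hκ.trans (Order.le_succ κ))
      (KMinusMonoid.ofAddCommMonoid (VFin R)) (vKappa R κ hκ) (VFin.incl hκ) := by
  refine isUniversalExtension_of_sum (isKMinusHom_vKappa hκ rfl (VFin.incl_sum hκ)) (fun c => ?_)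
    fun K C φ hφ c c' hcc' => ?_
  · have hP := c.2.1
    obtain ⟨I, N, hN, ⟨e⟩⟩ := hR c.1.rep c.2.1
    have hNP : ∀ i, Module.Projective Rᵐᵒᵖ (N i) := by
      classical
      intro i
      have := Module.Projective.of_equiv e
      refine Module.Projective.of_split (DirectSum.lof Rᵐᵒᵖ I (fun i => N i) i)
        (DirectSum.component Rᵐᵒᵖ I (fun i => N i) i) (LinearMap.ext fun m => ?_)
      exact DirectSum.component.lof_self Rᵐᵒᵖ (M := fun i => N i) i m
    refine exists_sum_eq_of_dsum (A := KMinusMonoid.ofAddCommMonoid (VFin R)) hκ rfl c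
      (fun i => ⟨ModClass.mk (N i), ModClass.isProjFG_mk.2 ⟨hNP i, hN i⟩⟩) ?_
    exact (ModClass.mk_rep c.1).symm.trans
      ((ModClass.mk_eq_mk.2 ⟨e⟩).trans (ModClass.dsum_mk fun i => N i).symm)
  -- Finitely generated modules have fewer than `ℵ₁` generators, so the uncountable argument first
  -- reduces to countable blocks; on these the zigzag is available.
  · have hfg : ∀ c : VFin R, ∃ s : Set c.1.rep, #s < Order.succ ℵ₀ ∧
        Submodule.span Rᵐᵒᵖ s = ⊤ := by
      intro c
      obtain ⟨s, hs⟩ := c.2.2.fg_top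
      exact ⟨s, (Cardinal.lt_aleph0_of_finite _).trans (Order.lt_succ _), hs⟩
    obtain ⟨e⟩ := ModClass.mk_eq_mk.1 (congrArg Subtype.val hcc')
    obtain ⟨a, b, ha, hb, hab⟩ := exists_block_decomposition
      (Cardinal.isRegular_succ le_rfl) (Order.lt_succ ℵ₀) (P := fun i => ((c i).1.rep : Type u))
      (Q := fun j => ((c' j).1.rep : Type u)) (fun i => hfg (c i)) (fun j => hfg (c' j)) e
    have hκκ := nonempty_sum_cardIdx_embedding hκ
    have hid : Nonempty (CardIdx κ ↪ CardIdx κ) := ⟨Function.Embedding.refl _⟩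
    rw [← C.tot_cardIdx, ← C.tot_cardIdx, C.tot_fiber hid hκκ a, C.tot_fiber hid hκκ b]
    congr 1
    funext t
    have : Countable {i // a i = t} := Cardinal.mk_le_aleph0_iff.1 (Order.le_of_lt_succ (ha t))
    have : Countable {j // b j = t} := Cardinal.mk_le_aleph0_iff.1 (Order.le_of_lt_succ (hb t))
    exact VFin.tot_eq_tot_of_countable hκ hφ _ _ (ModClass.mk_eq_mk.2 (hab t))

end

/-! ### The theorem -/

theorem mainTheorem3 (R : Type u) [Ring R] (κ : Cardinal.{u}) (hκ : ℵ₀ ≤ κ) :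
    (∀ (θ : Cardinal.{u}) (hθ : θ.IsRegular) (hle : θ ≤ Order.succ κ), ℵ₁ ≤ θ →
      IsUniversalExtension.{u, u + 1, w} hle (vMinus R θ hθ) (vKappa R κ hκ) (VMinus.incl hle)) ∧
    IsUniversalExtension.{u, u + 1, w} (Order.succ_le_succ hκ)
      ((vKappa R ℵ₀ le_rfl).toMinus (Order.succ ℵ₀) (Cardinal.isRegular_succ le_rfl) le_rfl)
      (vKappa R κ hκ) (VKappa.incl hκ) ∧
    ((∀ (P : Type u) [AddCommGroup P] [Module Rᵐᵒᵖ P], Module.Projective Rᵐᵒᵖ P →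
        ∃ (I : Type u) (N : I → ModuleCat.{u} Rᵐᵒᵖ),
          (∀ i, Module.Finite Rᵐᵒᵖ (N i)) ∧ Nonempty (P ≃ₗ[Rᵐᵒᵖ] ⨁ i, N i)) →
      IsUniversalExtension.{u, u + 1, w} (hκ.trans (Order.le_succ κ))
        (KMinusMonoid.ofAddCommMonoid (VFin R)) (vKappa R κ hκ) (VFin.incl hκ)) := by
  refine ⟨fun θ hθ hle h1 => ?_, ?_, isUniversalExtension_vFin hκ⟩
  · refine isUniversalExtension_vKappa hκ (aleph0_lt_aleph_one.trans_le h1) rfl (fun _ _ => rfl)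
      (fun _ _ h => Subtype.ext (congrArg (fun c : VKappa R κ => c.1) h)) (fun c => c.2)
      fun c hc => ?_
    exact ⟨⟨c.1, hc⟩, rfl⟩
  -- At most `ℵ₀` generators means fewer than `ℵ₁`, so this is again the uncountable case, with `θ`
  -- the successor of `ℵ₀`; only the sum is defined differently, through `sumOver`.
  · refine isUniversalExtension_vKappa hκ (Order.lt_succ _) rfl
      (fun x hx => vKappa_sumOver le_rfl x (Order.le_of_lt_succ hx))
      (fun _ _ h => Subtype.ext (congrArg (fun c : VKappa R κ => c.1) h)) (fun c => ?_)
      fun c hc => ?_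
    · exact ⟨c.2.1, c.2.2.imp fun _ h => ⟨Order.lt_succ_of_le h.1, h.2⟩⟩
    · exact ⟨⟨c.1, hc.isProjLE le_rfl⟩, rfl⟩
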